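/- Let $\Omega\subset\mathbb R^2$ be a bounded domain, let $M,\nu,\gamma,\epsilon,T>0$ and $\delta\in\mathbb R$ be constants, and put $$G(s)=\tfrac1{4\epsilon^2}(1-s^2)^2,\qquad F(s)=G(s)-\tfrac\gamma2 s^2,\qquad E_1(\phi)=\int_\Omega F(\phi)\,dx .$$ For $N\in\mathbb N$, $N\ge 1$, let $\Delta t=T/N$ and $t^n=n\Delta t$. Write $(\cdot,\cdot)$ for the pairing $\int_\Omega fg\,dx$ and $\|\cdot\|$ for the norm of $L^2(\Omega)$. Let $L^{1,2}(\Omega)$ be the space of locally integrable functions on $\Omega$ with weak gradient in $L^2(\Omega)^2$ (this is $H^1(\Omega)$ if $\partial\Omega$ is Lipschitz), and let $\mathbf H$ be the space of all $\mathbf v\in L^2(\Omega)^2$ with $\nabla\cdot\mathbf v=0$ and $\mathbf v\cdot\mathbf n|_{\partial\Omega}=0$ in the weak sense, that is, $(\mathbf v,\nabla\psi)=0$ for all $\psi\in L^{1,2}(\Omega)$. Let $0\le n<N$. Call $(\phi^n,\mu^n,\mathbf u^n,p^n,r^n,q^n)$ admissible if $\phi^n,\mu^n\in H^1(\Omega)$,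 $\mathbf u^n\in H^1(\Omega)^2\cap\mathbf H$, $p^n\in L^{1,2}(\Omega)$, $r^n,q^n\in\mathbb R$, $F(\phi^n)\in L^1(\Omega)$, $E_1(\phi^n)+\delta>0$, and the products $F'(\phi^n)\psi$, $(\mathbf u^n\cdot\nabla\phi^n)\psi$, $\mu^n\nabla\phi^n\cdot\mathbf w$, $(\mathbf u^n\cdot\nabla)\mathbf u^n\cdot\mathbf w$ are integrable on $\Omega$ for all $\psi\in H^1(\Omega)$ and $\mathbf w\in H^1_0(\Omega)^2$. Given an admissible $(\phi^n,\mu^n,\mathbf u^n,p^n,r^n,q^n)$, the first-order fully decoupled MSAV pressure-correction scheme for the Cahn–Hilliard–Navier–Stokes system asks for $\phi^{n+1},\mu^{n+1}\in H^1(\Omega)$, $\tilde{\mathbf u}^{n+1}\in H^1_0(\Omega)^2$, $\mathbf u^{n+1}\in \mathbf H$, $p^{n+1}\in L^{1,2}(\Omega)$ and $r^{n+1},q^{n+1}\in\mathbb R$ with \begin{align*} &\frac{\phi^{n+1}-\phi^n}{\Delta t}+\frac{r^{n+1}}{\sqrt{E_1(\phi^n)+\delta}}(\mathbf u^n\cdot\nabla)\phi^n=M\Delta\mu^{n+1},\qquad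 \frac{\partial\mu^{n+1}}{\partial\mathbf n}\Big|_{\partial\Omega}=0,\\ &\mu^{n+1}=-\Delta\phi^{n+1}+\gamma\phi^{n+1}+\frac{r^{n+1}}{\sqrt{E_1(\phi^n)+\delta}}F'(\phi^n),\qquad \frac{\partial\phi^{n+1}}{\partial\mathbf n}\Big|_{\partial\Omega}=0,\\ &\frac{r^{n+1}-r^n}{\Delta t}=\frac1{2\sqrt{E_1(\phi^n)+\delta}}\Big(\big(F'(\phi^n),\tfrac{\phi^{n+1}-\phi^n}{\Delta t}\big)+(\mu^{n+1},\mathbf u^n\cdot\nabla\phi^n)-(\tilde{\mathbf u}^{n+1},\mu^n\nabla\phi^n)\Big),\\ &\frac{\tilde{\mathbf u}^{n+1}-\mathbf u^n}{\Delta t}+\exp\big(\tfrac{t^{n+1}}T\big)q^{n+1}\,\mathbf u^n\cdot\nabla\mathbf u^n-\nu\Delta\tilde{\mathbf u}^{n+1}+\nabla p^n=\frac{r^{n+1}}{\sqrt{E_1(\phi^n)+\delta}}\,\mu^n\nabla\phi^n,\\ &\frac{\mathbf u^{n+1}-\tilde{\mathbf u}^{n+1}}{\Delta t}+\nabla(p^{n+1}-p^n)=0,\\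 &\frac{q^{n+1}-q^n}{\Delta t}=-\frac1Tq^{n+1}+\exp\big(\tfrac{t^{n+1}}T\big)(\mathbf u^n\cdot\nabla\mathbf u^n,\tilde{\mathbf u}^{n+1}), \end{align*} where the two equations with Neumann conditions are understood in the weak sense with test functions in $H^1(\Omega)$, and the equation for $\tilde{\mathbf u}^{n+1}$ in the weak sense with test functions in $H^1_0(\Omega)^2$. Let $$\tilde E^{k}=\|\nabla\phi^{k}\|^2+\gamma\|\phi^{k}\|^2+2|r^{k}|^2+\|\mathbf u^{k}\|^2+(\Delta t)^2\|\nabla p^{k}\|^2+|q^{k}|^2 .$$ 1. (Unconditional energy stability.) For every $N\ge1$, every $0\le n<N$, every admissible $(\phi^n,\mu^n,\mathbf u^n,p^n,r^n,q^n)$ and every solution of the scheme, $$\tilde E^{n+1}-\tilde E^n\le-2M\Delta t\|\nabla\mu^{n+1}\|^2-2\nu\Delta t\|\nabla\tilde{\mathbf u}^{n+1}\|^2-\frac{2\Delta t}T|q^{n+1}|^2 .$$ 2. (Unique solvability.) There is $\tau_0>0$, depending only on $\Omega$ and the constants $M,\nu,\gamma,\epsilon,\delta,T$, such that for all $N\ge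 1$ with $\Delta t=T/N\le\tau_0$, all $0\le n<N$ and all admissible $(\phi^n,\mu^n,\mathbf u^n,p^n,r^n,q^n)$ the scheme has a solution $(\phi^{n+1},\mu^{n+1},\tilde{\mathbf u}^{n+1},\mathbf u^{n+1},p^{n+1},r^{n+1},q^{n+1})$, and it is unique, with $p^{n+1}$ unique up to an additive constant. -/

import Mathlib

open MeasureTheory

namespace CHNS

noncomputable section

/-- The plane with its Euclidean norm. -/
abbrev E2 : Type := EuclideanSpace ℝ (Fin 2)

/-! ### Weak derivatives and function spaces on an open set -/

/-- `g` is a weak (distributional) gradient of the locally integrable function `f` on `Ω`. -/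
def IsWeakGrad (Ω : Set E2) (f : E2 → ℝ) (g : E2 → E2) : Prop :=
  LocallyIntegrableOn f Ω ∧ LocallyIntegrableOn g Ω ∧
    ∀ ψ : E2 → ℝ, ContDiff ℝ (⊤ : ℕ∞) ψ → HasCompactSupport ψ → tsupport ψ ⊆ Ω →
      ∀ v : E2, ∫ x in Ω, f x * fderiv ℝ ψ x v = -∫ x in Ω, ψ x * inner ℝ (g x) v

open Classical in
/-- The weak gradient on `Ω`, unique almost everywhere on `Ω` where it exists. -/
def weakGrad (Ω : Set E2) (f : E2 → ℝ) : E2 → E2 :=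
  if h : ∃ g, IsWeakGrad Ω f g then h.choose else 0

/-- The Sobolev space `H¹(Ω)`. -/
def MemH1 (Ω : Set E2) (f : E2 → ℝ) : Prop :=
  MemLp f 2 (volume.restrict Ω) ∧
    ∃ g, IsWeakGrad Ω f g ∧ MemLp g 2 (volume.restrict Ω)

/-- The space `H¹₀(Ω)`: the closure of `C_c^∞(Ω)` in `H¹(Ω)`. -/
def MemH10 (Ω : Set E2) (f : E2 → ℝ) : Prop :=
  MemH1 Ω f ∧ ∀ ε : ℝ, 0 < ε → ∃ ψ : E2 → ℝ,
    ContDiff ℝ (⊤ : ℕ∞) ψ ∧ HasCompactSupport ψ ∧ tsupport ψ ⊆ Ω ∧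
      (∫ x in Ω, (f x - ψ x) ^ 2) + (∫ x in Ω, ‖weakGrad Ω f x - gradient ψ x‖ ^ 2) < ε

/-- Vector fields with both components in `H¹(Ω)`. -/
def MemH1Vec (Ω : Set E2) (v : E2 → E2) : Prop := ∀ i, MemH1 Ω (fun x => v x i)

/-- Vector fields with both components in `H¹₀(Ω)`. -/
def MemH10Vec (Ω : Set E2) (v : E2 → E2) : Prop := ∀ i, MemH10 Ω (fun x => v x i)

/-- The space of pressures: locally integrable functions whose weak gradient is in `L²(Ω)`.
For a bounded domain with Lipschitz boundary this is `H¹(Ω)`. -/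
def MemPressure (Ω : Set E2) (p : E2 → ℝ) : Prop :=
  ∃ g, IsWeakGrad Ω p g ∧ MemLp g 2 (volume.restrict Ω)

/-- The space of `v ∈ L²(Ω)²` with `div v = 0` in `Ω` and `v · n = 0` on `∂Ω`, both in the
weak sense: `v` is orthogonal in `L²` to all square integrable gradients. -/
def MemH (Ω : Set E2) (v : E2 → E2) : Prop :=
  MemLp v 2 (volume.restrict Ω) ∧
    ∀ ψ : E2 → ℝ, MemPressure Ω ψ → ∫ x in Ω, inner ℝ (v x) (weakGrad Ω ψ x) = 0

/-- The convective term `(u · ∇) v`. -/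
def convect (Ω : Set E2) (u v : E2 → E2) (x : E2) : E2 :=
  WithLp.toLp 2 (fun i => inner ℝ (u x) (weakGrad Ω (fun y => v y i) x))

/-! ### The Cahn-Hilliard-Navier-Stokes system -/

/-- The constants of the system and of its reformulation: mobility, viscosity, interfacial
width, the constant of the quadratic splitting, the shift of the energy, and the final time. -/
structure Params where
  M : ℝ
  ν : ℝ
  ε : ℝ
  γ : ℝ
  δ : ℝ
  T : ℝ

/-- The double well potential `G`. -/
def G (P : Params) (s : ℝ) : ℝ := 1 / (4 * P.ε ^ 2) * (1 - s ^ 2) ^ 2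

/-- The potential `F(s) = G(s) - (γ / 2) s²`. -/
def F (P : Params) (s : ℝ) : ℝ := G P s - P.γ / 2 * s ^ 2

/-- The derivative `F'`. -/
def F' (P : Params) (s : ℝ) : ℝ := deriv (F P) s

/-- The nonlinear energy `E₁(φ) = ∫_Ω F(φ)`. -/
def E1 (Ω : Set E2) (P : Params) (φ : E2 → ℝ) : ℝ := ∫ x in Ω, F P (φ x)

/-! ### The first-order scheme -/

/-- The unknowns kept at one time level: phase function, chemical potential, velocity,
pressure, and the two scalar auxiliary variables. -/
structure State where
  φ : E2 → ℝ
  μ : E2 → ℝ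
  u : E2 → E2
  p : E2 → ℝ
  r : ℝ
  q : ℝ

/-- A state from which a step of the scheme can be formed: its components lie in the natural
energy spaces, all integrals in the weak form of the scheme that contain one of its nonlinear
terms converge absolutely, and the square root `√(E₁(φ) + δ)` is that of a positive number. -/
structure Admissible (Ω : Set E2) (P : Params) (s : State) : Prop where
  phi_mem : MemH1 Ω s.φ
  mu_mem : MemH1 Ω s.μ
  u_mem : MemH1Vec Ω s.u
  u_solenoidal : MemH Ω s.u
  p_mem : MemPressure Ω s.p
  F_integrable : IntegrableOn (fun x => F P (s.φ x)) Ω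
  E1_pos : 0 < E1 Ω P s.φ + P.δ
  F'_pairing : ∀ ψ, MemH1 Ω ψ → IntegrableOn (fun x => F' P (s.φ x) * ψ x) Ω
  advection_pairing : ∀ ψ, MemH1 Ω ψ →
    IntegrableOn (fun x => inner ℝ (s.u x) (weakGrad Ω s.φ x) * ψ x) Ω
  capillary_pairing : ∀ w, MemH10Vec Ω w →
    IntegrableOn (fun x => inner ℝ (w x) (s.μ x • weakGrad Ω s.φ x)) Ω
  convection_pairing : ∀ w, MemH10Vec Ω w →
    IntegrableOn (fun x => inner ℝ (convect Ω s.u s.u x) (w x)) Ω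

/-- One step of the first-order scheme with time step `τ`, from the state `s` at the old time
level to the state `s'` at the new time level `t`, with intermediate velocity `ut`. The elliptic
equations are in weak form, with homogeneous Neumann conditions for `φ` and `μ`. -/
structure IsStep (Ω : Set E2) (P : Params) (τ t : ℝ) (s : State) (ut : E2 → E2) (s' : State) :
    Prop where
  phi_mem : MemH1 Ω s'.φ
  mu_mem : MemH1 Ω s'.μ
  ut_mem : MemH10Vec Ω ut
  p_mem : MemPressure Ω s'.p
  /-- Transport and diffusion of the phase function. -/
  phi_eq : ∀ ψ, MemH1 Ω ψ →
    (∫ x in Ω, (s'.φ x - s.φ x) / τ * ψ x)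
      + s'.r / √(E1 Ω P s.φ + P.δ) * (∫ x in Ω, inner ℝ (s.u x) (weakGrad Ω s.φ x) * ψ x)
      = -P.M * ∫ x in Ω, inner ℝ (weakGrad Ω s'.μ x) (weakGrad Ω ψ x)
  /-- Chemical potential. -/
  mu_eq : ∀ ψ, MemH1 Ω ψ →
    (∫ x in Ω, s'.μ x * ψ x)
      = (∫ x in Ω, inner ℝ (weakGrad Ω s'.φ x) (weakGrad Ω ψ x))
        + P.γ * (∫ x in Ω, s'.φ x * ψ x)
        + s'.r / √(E1 Ω P s.φ + P.δ) * (∫ x in Ω, F' P (s.φ x) * ψ x)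
  /-- First scalar auxiliary variable. -/
  r_eq : (s'.r - s.r) / τ
      = 1 / (2 * √(E1 Ω P s.φ + P.δ)) *
        ((∫ x in Ω, F' P (s.φ x) * ((s'.φ x - s.φ x) / τ))
          + (∫ x in Ω, inner ℝ (s.u x) (weakGrad Ω s.φ x) * s'.μ x)
          - (∫ x in Ω, inner ℝ (ut x) (s.μ x • weakGrad Ω s.φ x)))
  /-- Intermediate velocity, vanishing on the boundary. -/
  ut_eq : ∀ w, MemH10Vec Ω w →
    (∫ x in Ω, inner ℝ (τ⁻¹ • (ut x - s.u x)) (w x))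
      + Real.exp (t / P.T) * s'.q * (∫ x in Ω, inner ℝ (convect Ω s.u s.u x) (w x))
      + P.ν * (∑ i, ∫ x in Ω,
          inner ℝ (weakGrad Ω (fun y => ut y i) x) (weakGrad Ω (fun y => w y i) x))
      + (∫ x in Ω, inner ℝ (weakGrad Ω s.p x) (w x))
      = s'.r / √(E1 Ω P s.φ + P.δ)
          * (∫ x in Ω, inner ℝ (w x) (s.μ x • weakGrad Ω s.φ x))
  /-- The new velocity is divergence free with vanishing normal component. -/
  u_solenoidal : MemH Ω s'.u
  /-- Pressure correction. -/
  p_eq : ∀ᵐ x ∂(volume.restrict Ω),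
    τ⁻¹ • (s'.u x - ut x) + weakGrad Ω (fun y => s'.p y - s.p y) x = 0
  /-- Second scalar auxiliary variable. -/
  q_eq : (s'.q - s.q) / τ
      = -(1 / P.T) * s'.q
        + Real.exp (t / P.T) * (∫ x in Ω, inner ℝ (convect Ω s.u s.u x) (ut x))

/-- The modified discrete energy of a state, for the time step `τ`. -/
def energy (Ω : Set E2) (P : Params) (τ : ℝ) (s : State) : ℝ :=
  (∫ x in Ω, ‖weakGrad Ω s.φ x‖ ^ 2) + P.γ * (∫ x in Ω, s.φ x ^ 2) + 2 * s.r ^ 2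
    + (∫ x in Ω, ‖s.u x‖ ^ 2) + τ ^ 2 * (∫ x in Ω, ‖weakGrad Ω s.p x‖ ^ 2) + s.q ^ 2

/-- Equality of two results of a step as elements of the function spaces, the pressure being
determined up to an additive constant. -/
structure SameStep (Ω : Set E2) (ut₁ : E2 → E2) (s₁ : State) (ut₂ : E2 → E2) (s₂ : State) :
    Prop where
  phi : s₁.φ =ᵐ[volume.restrict Ω] s₂.φ
  mu : s₁.μ =ᵐ[volume.restrict Ω] s₂.μ
  ut : ut₁ =ᵐ[volume.restrict Ω] ut₂
  u : s₁.u =ᵐ[volume.restrict Ω] s₂.u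
  p : ∃ c : ℝ, ∀ᵐ x ∂(volume.restrict Ω), s₁.p x = s₂.p x + c
  r : s₁.r = s₂.r
  q : s₁.q = s₂.q

end

end CHNS

/-!
A step of the scheme is a linear problem for the new unknowns, because every nonlinear term is
taken at the old time level and multiplied by one of the two scalar unknowns.

*Energy inequality.* The equation for `φ` is tested with `μ`, that for `μ` with the increment of
`φ`, that for the intermediate velocity with itself, and the scalar equations are multiplied by the
new scalars. The nonlinear terms then cancel in pairs (`IsStep.energy_le`). In the pressure
correction the new velocity is orthogonal to gradients, so that squaring
`u' + τ ∇p' = ũ + τ ∇p` relates `‖u'‖² + τ² ‖∇p'‖²` to `‖ũ‖²` and `∇p`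
(`IsStep.pressure_identity`).

*Solvability of the decoupled part.* The same cancellation makes the coupled problem for `φ`, `μ`,
the intermediate velocity and the two scalars coercive, except that `μ` is controlled only through
its gradient. Testing the equation for `μ` with `ψ - κ χ` for a small `κ > 0`, where `χ` tests the
equation for `φ`, supplies the missing term, so the Lax-Milgram theorem applies for every positive
time step (`exists_unique_isCoupledSolution`). The data are only assumed to pair integrably with each
test function; that these pairings are bounded functionals on `H¹(Ω)` and `H¹₀(Ω)²` follows from
the closed graph theorem (`exists_continuous_pairing`).

*Pressure correction.* The new velocity is the solenoidal part of the intermediate one, and the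
pressure increment is its gradient part divided by `τ` (`exists_helmholtz`). No regularity of the
boundary is available, so one has to see directly that square integrable gradients form a closed
subspace of `L²`: on a small ball a function differs from a constant, in `L¹`, by at most a
multiple of `∫ |∇f|`, and chains of balls in the connected set `Ω` transport one fixed constant
to every point (`exists_isWeakGrad_of_tendsto`). The same argument shows that a function with
vanishing weak gradient is constant, whence uniqueness of the pressure up to a constant.

Since solvability holds for all positive time steps, the threshold is taken to be `1`.
-/

namespace CHNS

/-! ### Weak gradients -/

/-- `ψ` belongs to `C_c^∞(Ω)`. -/
structure IsTest (Ω : Set E2) (ψ : E2 → ℝ) : Prop where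
  smooth : ContDiff ℝ (⊤ : ℕ∞) ψ
  compact : HasCompactSupport ψ
  support : tsupport ψ ⊆ Ω

variable {Ω : Set E2} {f f₁ f₂ : E2 → ℝ} {g g₁ g₂ : E2 → E2} {ψ : E2 → ℝ}

lemma integrable_smul_of_tsupport_subset {V : Type*} [NormedAddCommGroup V] [NormedSpace ℝ V]
    {h : E2 → V} (hh : LocallyIntegrableOn h Ω) (hψ : Continuous ψ) (hc : HasCompactSupport ψ)
    (hs : tsupport ψ ⊆ Ω) : Integrable (fun x => ψ x • h x) := by
  have h1 : IntegrableOn (fun x => ψ x • h x) (tsupport ψ) :=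
    (hh.integrableOn_compact_subset hs hc).continuousOn_smul hψ.continuousOn hc
  rwa [integrableOn_iff_integrable_of_support_subset] at h1
  intro x hx
  apply subset_tsupport ψ
  intro h0
  apply hx
  simp [h0]

lemma IsTest.continuous (h : IsTest Ω ψ) : Continuous ψ := h.smooth.continuous

lemma IsTest.continuous_fderiv_apply (h : IsTest Ω ψ) (v : E2) :
    Continuous (fun x => fderiv ℝ ψ x v) :=
  (h.smooth.continuous_fderiv (by simp)).clm_apply continuous_const

lemma IsTest.compact_fderiv_apply (h : IsTest Ω ψ) (v : E2) :
    HasCompactSupport (fun x => fderiv ℝ ψ x v) :=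
  h.compact.fderiv_apply (𝕜 := ℝ) v

lemma IsTest.support_fderiv_apply (h : IsTest Ω ψ) (v : E2) :
    tsupport (fun x => fderiv ℝ ψ x v) ⊆ Ω :=
  (tsupport_fderiv_apply_subset ℝ v).trans h.support

lemma IsTest.integrable_smul (h : IsTest Ω ψ) {V : Type*} [NormedAddCommGroup V] [NormedSpace ℝ V]
    {k : E2 → V} (hk : LocallyIntegrableOn k Ω) : Integrable (fun x => ψ x • k x) :=
  integrable_smul_of_tsupport_subset hk h.continuous h.compact h.support

lemma IsTest.integrable_mul_fderiv (h : IsTest Ω ψ) (hf : LocallyIntegrableOn f Ω) (v : E2) :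
    Integrable (fun x => f x * fderiv ℝ ψ x v) := by
  have := integrable_smul_of_tsupport_subset hf (h.continuous_fderiv_apply v)
    (h.compact_fderiv_apply v) (h.support_fderiv_apply v)
  simpa [smul_eq_mul, mul_comm] using this

lemma IsTest.integrable_mul_inner (h : IsTest Ω ψ) (hg : LocallyIntegrableOn g Ω) (v : E2) :
    Integrable (fun x => ψ x * inner ℝ (g x) v) := by
  have := (h.integrable_smul hg).inner_const v (𝕜 := ℝ)
  simpa [real_inner_smul_left] using this

lemma IsTest.setIntegral_eq (h : IsTest Ω ψ) {V : Type*} [NormedAddCommGroup V] [NormedSpace ℝ V]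
    (k : E2 → V) : ∫ x in Ω, ψ x • k x = ∫ x, ψ x • k x := by
  apply setIntegral_eq_integral_of_forall_compl_eq_zero
  intro x hx
  rw [image_eq_zero_of_notMem_tsupport (fun h' => hx (h.support h')), zero_smul]

lemma IsWeakGrad.identity (h : IsWeakGrad Ω f g) (hψ : IsTest Ω ψ) (v : E2) :
    ∫ x in Ω, f x * fderiv ℝ ψ x v = -∫ x in Ω, ψ x * inner ℝ (g x) v :=
  h.2.2 ψ hψ.smooth hψ.compact hψ.support v

lemma IsWeakGrad.congr (h : IsWeakGrad Ω f g) (hf : f =ᵐ[volume.restrict Ω] f₁)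
    (hg : g =ᵐ[volume.restrict Ω] g₁) : IsWeakGrad Ω f₁ g₁ := by
  refine ⟨h.1.congr hf, h.2.1.congr hg, fun ψ h1 h2 h3 v => ?_⟩
  have := h.2.2 ψ h1 h2 h3 v
  have e₁ : ∫ x in Ω, f x * fderiv ℝ ψ x v = ∫ x in Ω, f₁ x * fderiv ℝ ψ x v :=
    integral_congr_ae (by filter_upwards [hf] with x hx; rw [hx])
  have e₂ : ∫ x in Ω, ψ x * inner ℝ (g x) v = ∫ x in Ω, ψ x * inner ℝ (g₁ x) v :=
    integral_congr_ae (by filter_upwards [hg] with x hx; rw [hx])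
  rw [← e₁, ← e₂, this]

lemma IsWeakGrad.add (h₁ : IsWeakGrad Ω f₁ g₁) (h₂ : IsWeakGrad Ω f₂ g₂) :
    IsWeakGrad Ω (fun x => f₁ x + f₂ x) (fun x => g₁ x + g₂ x) := by
  refine ⟨h₁.1.add h₂.1, h₁.2.1.add h₂.2.1, fun ψ a b c v => ?_⟩
  have hψ : IsTest Ω ψ := ⟨a, b, c⟩
  simp only [add_mul, inner_add_left, mul_add]
  rw [integral_add (hψ.integrable_mul_fderiv h₁.1 v).integrableOn
      (hψ.integrable_mul_fderiv h₂.1 v).integrableOn,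
    integral_add (hψ.integrable_mul_inner h₁.2.1 v).integrableOn
      (hψ.integrable_mul_inner h₂.2.1 v).integrableOn, h₁.identity hψ, h₂.identity hψ]
  ring

lemma IsWeakGrad.const_smul (h : IsWeakGrad Ω f g) (c : ℝ) :
    IsWeakGrad Ω (fun x => c * f x) (fun x => c • g x) := by
  refine ⟨h.1.smul c, h.2.1.smul c, fun ψ a b d v => ?_⟩
  have hψ : IsTest Ω ψ := ⟨a, b, d⟩
  simp only [mul_assoc, real_inner_smul_left, mul_left_comm _ c, integral_const_mul]
  rw [h.identity hψ]
  ring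

lemma IsWeakGrad.sub (h₁ : IsWeakGrad Ω f₁ g₁) (h₂ : IsWeakGrad Ω f₂ g₂) :
    IsWeakGrad Ω (fun x => f₁ x - f₂ x) (fun x => g₁ x - g₂ x) := by
  have := h₁.add (h₂.const_smul (-1))
  simpa [sub_eq_add_neg] using this

lemma gradient_continuous {f : E2 → ℝ} (hf : ContDiff ℝ (⊤ : ℕ∞) f) : Continuous (gradient f) :=
  (InnerProductSpace.toDual ℝ E2).symm.continuous.comp (hf.continuous_fderiv (by simp))

lemma inner_gradient (f : E2 → ℝ) (x v : E2) : inner ℝ (gradient f x) v = fderiv ℝ f x v := by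
  rw [gradient, InnerProductSpace.toDual_symm_apply]

/-- Integration by parts: the classical gradient of a smooth function is its weak gradient. -/
lemma isWeakGrad_gradient (hf : ContDiff ℝ (⊤ : ℕ∞) f) : IsWeakGrad Ω f (gradient f) := by
  have hfl : LocallyIntegrableOn f Ω := hf.continuous.locallyIntegrable.locallyIntegrableOn _
  have hgl : LocallyIntegrableOn (gradient f) Ω :=
    (gradient_continuous hf).locallyIntegrable.locallyIntegrableOn _
  refine ⟨hfl, hgl, fun ψ a b c v => ?_⟩
  have hψ : IsTest Ω ψ := ⟨a, b, c⟩
  have e1 : ∫ x in Ω, f x * fderiv ℝ ψ x v = ∫ x, f x * fderiv ℝ ψ x v := by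
    apply setIntegral_eq_integral_of_forall_compl_eq_zero
    intro x hx
    rw [image_eq_zero_of_notMem_tsupport (f := fun x => fderiv ℝ ψ x v)
      (fun h' => hx (hψ.support_fderiv_apply v h')), mul_zero]
  have e2 := hψ.setIntegral_eq (fun x => inner ℝ (gradient f x) v)
  simp only [smul_eq_mul] at e2
  rw [e1, e2, integral_mul_fderiv_eq_neg_fderiv_mul_of_integrable]
  · simp only [inner_gradient, mul_comm]
  · simpa only [inner_gradient, mul_comm] using hψ.integrable_mul_inner hgl v
  · exact hψ.integrable_mul_fderiv hfl v
  · simpa only [smul_eq_mul, mul_comm] using hψ.integrable_smul hfl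
  · exact fun x _ => (hf.differentiable (by simp)).differentiableAt
  · exact fun x _ => (a.differentiable (by simp)).differentiableAt

lemma isWeakGrad_const (c : ℝ) : IsWeakGrad Ω (fun _ => c) (fun _ => 0) := by
  have := isWeakGrad_gradient (Ω := Ω) (f := fun _ : E2 => c) contDiff_const
  convert this using 2
  simp [gradient]

/-- A weak gradient is unique up to a null set, by the fundamental lemma of the calculus of
variations. -/
lemma IsWeakGrad.ae_unique (hΩ : IsOpen Ω) (h₁ : IsWeakGrad Ω f g₁) (h₂ : IsWeakGrad Ω f g₂) :
    g₁ =ᵐ[volume.restrict Ω] g₂ := by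
  have h := hΩ.ae_eq_zero_of_integral_contDiff_smul_eq_zero (h₁.2.1.sub h₂.2.1) (fun ψ a b c => by
    have hψ : IsTest Ω ψ := ⟨a, b, c⟩
    apply ext_inner_right ℝ
    intro v
    rw [real_inner_comm, ← integral_inner (hψ.integrable_smul (h₁.2.1.sub h₂.2.1)), inner_zero_left]
    simp only [inner_smul_right, Pi.sub_apply, inner_sub_right, mul_sub]
    have i₁ := h₁.identity hψ v
    have i₂ := h₂.identity hψ v
    have e₁ := hψ.setIntegral_eq (fun x => inner ℝ (g₁ x) v)
    have e₂ := hψ.setIntegral_eq (fun x => inner ℝ (g₂ x) v)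
    simp only [smul_eq_mul] at e₁ e₂
    simp only [real_inner_comm _ v]
    rw [integral_sub (hψ.integrable_mul_inner h₁.2.1 v) (hψ.integrable_mul_inner h₂.2.1 v)]
    linarith)
  rw [Filter.EventuallyEq, ae_restrict_iff' hΩ.measurableSet]
  filter_upwards [h] with x hx hxΩ
  exact sub_eq_zero.1 (hx hxΩ)

lemma isWeakGrad_weakGrad (h : ∃ g, IsWeakGrad Ω f g) : IsWeakGrad Ω f (weakGrad Ω f) := by
  rw [weakGrad, dif_pos h]
  exact h.choose_spec

lemma IsWeakGrad.weakGrad_ae_eq (hΩ : IsOpen Ω) (h : IsWeakGrad Ω f g) :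
    weakGrad Ω f =ᵐ[volume.restrict Ω] g :=
  (isWeakGrad_weakGrad ⟨g, h⟩).ae_unique hΩ h

/-! ### A local Poincaré inequality in `L¹` -/

section Mollification

open Filter Topology Metric
open scoped ENNReal Convolution

variable {Ω : Set E2} {f : E2 → ℝ} {g : E2 → E2} {x₀ : E2} {r R : ℝ}

lemma isTest_normed_sub (ρ : ContDiffBump (0 : E2)) (x : E2)
    (hx : closedBall x ρ.rOut ⊆ Ω) : IsTest Ω (fun y => ρ.normed volume (x - y)) := by
  have hsupp : tsupport (fun y => ρ.normed volume (x - y)) ⊆ closedBall x ρ.rOut := by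
    apply closure_minimal _ isClosed_closedBall
    intro y hy
    have : x - y ∈ Function.support (ρ.normed volume) := hy
    rw [ρ.support_normed_eq, mem_ball_zero_iff] at this
    rw [mem_closedBall, dist_comm, dist_eq_norm]
    exact this.le
  refine ⟨ρ.contDiff_normed.comp (contDiff_const.sub contDiff_id), ?_, hsupp.trans hx⟩
  exact (isCompact_closedBall x ρ.rOut).of_isClosed_subset (isClosed_tsupport _) hsupp

lemma fderiv_normed_sub (ρ : ContDiffBump (0 : E2)) (x y v : E2) :
    fderiv ℝ (fun y => ρ.normed volume (x - y)) y v = -fderiv ℝ (ρ.normed volume) (x - y) v := by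
  have h1 : HasFDerivAt (ρ.normed volume) (fderiv ℝ (ρ.normed volume) (x - y)) (x - y) :=
    ((ρ.contDiff_normed (n := 1)).differentiable (by simp)).differentiableAt.hasFDerivAt
  have h2 : HasFDerivAt (fun y : E2 => x - y) (-ContinuousLinearMap.id ℝ E2) y :=
    (hasFDerivAt_id y).const_sub x
  have h3 : HasFDerivAt (fun y => ρ.normed volume (x - y))
      ((fderiv ℝ (ρ.normed volume) (x - y)).comp (-ContinuousLinearMap.id ℝ E2)) y := h1.comp y h2
  rw [h3.fderiv]
  simp

/-- Mollification commutes with the weak gradient: the derivative of the mollified function is the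
mollified weak gradient, away from the boundary of the ball to which `f` is restricted. -/
lemma fderiv_mollified (hR : closedBall x₀ R ⊆ Ω) (h : IsWeakGrad Ω f g)
    (ρ : ContDiffBump (0 : E2)) {x : E2} (hx : closedBall x ρ.rOut ⊆ closedBall x₀ R) (v : E2) :
    fderiv ℝ (ρ.normed volume ⋆[ContinuousLinearMap.lsmul ℝ ℝ, volume]
        (closedBall x₀ R).indicator f) x v
      = ∫ y, ρ.normed volume (x - y) * inner ℝ ((closedBall x₀ R).indicator g y) v := by
  have hfi : Integrable ((closedBall x₀ R).indicator f) :=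
    (h.1.integrableOn_compact_subset hR (isCompact_closedBall _ _)).integrable_indicator
      measurableSet_closedBall
  have hψ := isTest_normed_sub (Ω := closedBall x₀ R) ρ x hx
  have hψΩ := isTest_normed_sub (Ω := Ω) ρ x (hx.trans hR)
  have hd := (ρ.hasCompactSupport_normed (μ := (volume : Measure E2))).hasFDerivAt_convolution_left
    (μ := (volume : Measure E2))
    (ContinuousLinearMap.lsmul ℝ ℝ) (ρ.contDiff_normed (n := 1)) hfi.locallyIntegrable x
  rw [hd.fderiv, convolution_eq_swap]
  have hint : Integrable (fun t => (ContinuousLinearMap.precompL E2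
      (ContinuousLinearMap.lsmul ℝ ℝ) (fderiv ℝ (ρ.normed volume) (x - t)))
        ((closedBall x₀ R).indicator f t)) := by
    have := ((ρ.hasCompactSupport_normed (μ := (volume : Measure E2))).fderiv (𝕜 := ℝ)).convolutionExists_left
      (μ := (volume : Measure E2))
      (ContinuousLinearMap.precompL E2 (ContinuousLinearMap.lsmul ℝ ℝ))
      ((ρ.contDiff_normed (n := 1)).continuous_fderiv (by simp)) hfi.locallyIntegrable x
    exact this.integrable_swap
  rw [ContinuousLinearMap.integral_apply hint]
  have hid := h.identity hψΩ v
  simp only [fderiv_normed_sub] at hid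
  have e1 : ∀ t, ((ContinuousLinearMap.precompL E2
      (ContinuousLinearMap.lsmul ℝ ℝ) (fderiv ℝ (ρ.normed volume) (x - t)))
        ((closedBall x₀ R).indicator f t)) v
      = -(Ω.indicator (fun t => f t * -fderiv ℝ (ρ.normed volume) (x - t) v) t) := by
    intro t
    simp only [ContinuousLinearMap.precompL_apply, ContinuousLinearMap.lsmul_apply, smul_eq_mul]
    by_cases ht : t ∈ closedBall x₀ R
    · rw [Set.indicator_of_mem ht, Set.indicator_of_mem (hR ht)]
      ring
    · have h0 : fderiv ℝ (fun y => ρ.normed volume (x - y)) t v = 0 :=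
        image_eq_zero_of_notMem_tsupport (f := fun t => fderiv ℝ (fun y => ρ.normed volume (x - y)) t v)
          (fun h' => ht (hψ.support_fderiv_apply v h'))
      rw [fderiv_normed_sub] at h0
      rw [Set.indicator_of_notMem ht]
      by_cases ht' : t ∈ Ω
      · rw [Set.indicator_of_mem ht', h0]
        ring
      · rw [Set.indicator_of_notMem ht']
        ring
  have e2 : ∫ y in Ω, ρ.normed volume (x - y) * inner ℝ (g y) v
      = ∫ y, ρ.normed volume (x - y) * inner ℝ ((closedBall x₀ R).indicator g y) v := by
    have := hψΩ.setIntegral_eq (fun y => inner ℝ (g y) v)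
    simp only [smul_eq_mul] at this
    rw [this]
    refine integral_congr_ae (Eventually.of_forall fun y => ?_)
    by_cases hy : y ∈ closedBall x₀ R
    · simp [Set.indicator_of_mem hy]
    · have : ρ.normed volume (x - y) = 0 :=
        image_eq_zero_of_notMem_tsupport (f := fun y => ρ.normed volume (x - y))
          (fun h' => hy (hψ.support h'))
      simp [this]
  simp only [e1]
  rw [integral_neg]
  have hind : ∫ t, Ω.indicator (fun t => f t * -fderiv ℝ (ρ.normed volume) (x - t) v) t
      = ∫ t in Ω, f t * -fderiv ℝ (ρ.normed volume) (x - t) v := by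
    rw [setIntegral_eq_integral_of_forall_compl_eq_zero]
    · refine integral_congr_ae (Eventually.of_forall fun y => ?_)
      by_cases hy : y ∈ Ω
      · simp [Set.indicator_of_mem hy]
      · have h0 := image_eq_zero_of_notMem_tsupport
          (f := fun t => fderiv ℝ (fun y => ρ.normed volume (x - y)) t v) (x := y)
          (fun h' => hy (hψΩ.support_fderiv_apply v h'))
        simp only [fderiv_normed_sub] at h0
        simp [Set.indicator_of_notMem hy, h0]
    · intro y hy
      have h0 := image_eq_zero_of_notMem_tsupport
        (f := fun t => fderiv ℝ (fun y => ρ.normed volume (x - y)) t v) (x := y)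
        (fun h' => hy (hψΩ.support_fderiv_apply v h'))
      simp only [fderiv_normed_sub] at h0
      simp [h0]
  rw [hind, hid, e2, neg_neg]

lemma lintegral_normed_sub (ρ : ContDiffBump (0 : E2)) (y : E2) :
    ∫⁻ x, ‖ρ.normed volume (x - y)‖ₑ = 1 := by
  rw [lintegral_sub_right_eq_self (fun x => ‖ρ.normed volume x‖ₑ) y]
  have h := ofReal_integral_norm_eq_lintegral_enorm (ρ.integrable_normed (μ := (volume : Measure E2)))
  rw [← h]
  simp only [Real.norm_of_nonneg (ρ.nonneg_normed _), ρ.integral_normed, ENNReal.ofReal_one]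

/-- Mollification does not increase the `L¹` norm. -/
lemma lintegral_mollified_le (ρ : ContDiffBump (0 : E2)) {G : E2 → ℝ≥0∞} (hG : Measurable G) :
    ∫⁻ x, ∫⁻ y, ‖ρ.normed volume (x - y)‖ₑ * G y = ∫⁻ y, G y := by
  have hm : Measurable (fun p : E2 × E2 => ‖ρ.normed volume (p.1 - p.2)‖ₑ * G p.2) :=
    ((ρ.continuous_normed.measurable.comp (measurable_fst.sub measurable_snd)).enorm).mul
      (hG.comp measurable_snd)
  rw [lintegral_lintegral_swap hm.aemeasurable]
  refine lintegral_congr fun y => ?_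
  rw [lintegral_mul_const, lintegral_normed_sub, one_mul]
  exact (ρ.continuous_normed.measurable.comp (measurable_id.sub_const y)).enorm

/-- The difference of a mollified function and its translate by `v`, in `L¹(s)`: integrate the
derivative along the segments from `x` to `x + v`. -/
lemma lintegral_translate_mollified_le (hR : closedBall x₀ R ⊆ Ω) (h : IsWeakGrad Ω f g)
    (hg : Measurable g)
    (ρ : ContDiffBump (0 : E2)) {s : Set E2} (v : E2)
    (hs : ∀ x ∈ s, ∀ t ∈ Set.Icc (0 : ℝ) 1,
      closedBall (x + t • v) ρ.rOut ⊆ closedBall x₀ R) (hsm : MeasurableSet s) :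
    ∫⁻ x in s, ‖(ρ.normed volume ⋆[ContinuousLinearMap.lsmul ℝ ℝ, volume]
          (closedBall x₀ R).indicator f) (x + v)
        - (ρ.normed volume ⋆[ContinuousLinearMap.lsmul ℝ ℝ, volume]
          (closedBall x₀ R).indicator f) x‖ₑ
      ≤ ‖v‖ₑ * ∫⁻ y in closedBall x₀ R, ‖g y‖ₑ := by
  set F := ρ.normed volume ⋆[ContinuousLinearMap.lsmul ℝ ℝ, volume]
          (closedBall x₀ R).indicator f with hF
  set G : E2 → ℝ≥0∞ := fun y => ‖(closedBall x₀ R).indicator g y‖ₑ with hGdef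
  have hG : Measurable G := (hg.indicator measurableSet_closedBall).enorm
  have hfi : Integrable ((closedBall x₀ R).indicator f) :=
    (h.1.integrableOn_compact_subset hR (isCompact_closedBall _ _)).integrable_indicator
      measurableSet_closedBall
  have hFs : ContDiff ℝ 1 F :=
    ρ.hasCompactSupport_normed.contDiff_convolution_left (n := 1) _ ρ.contDiff_normed
      hfi.locallyIntegrable
  have hpt : ∀ x ∈ s, ‖F (x + v) - F x‖ₑ
      ≤ ∫⁻ t in Set.Ioc (0 : ℝ) 1,
          ‖v‖ₑ * ∫⁻ y, ‖ρ.normed volume (x + t • v - y)‖ₑ * G y := by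
    intro x hx
    have hc : Continuous (fun t : ℝ => fderiv ℝ F (x + t • v) v) :=
      ((hFs.continuous_fderiv (by simp)).comp (by fun_prop)).clm_apply continuous_const
    have hftc : ∫ t in (0 : ℝ)..1, fderiv ℝ F (x + t • v) v = F (x + v) - F x := by
      rw [intervalIntegral.integral_eq_sub_of_hasDerivAt (f := fun t : ℝ => F (x + t • v))]
      · simp
      · intro t _
        have h1 : HasFDerivAt F (fderiv ℝ F (x + t • v)) (x + t • v) :=
          (hFs.differentiable (by simp)).differentiableAt.hasFDerivAt
        have h2 : HasDerivAt (fun t : ℝ => x + t • v) v t := by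
          simpa using ((hasDerivAt_id t).smul_const v).const_add x
        exact h1.comp_hasDerivAt t h2
      · exact hc.intervalIntegrable _ _
    rw [← hftc, intervalIntegral.integral_of_le zero_le_one]
    refine (enorm_integral_le_lintegral_enorm _).trans ?_
    refine setLIntegral_mono' measurableSet_Ioc fun t ht => ?_
    rw [fderiv_mollified hR h ρ (hs x hx t ⟨ht.1.le, ht.2⟩) v]
    refine (enorm_integral_le_lintegral_enorm _).trans ?_
    rw [← lintegral_const_mul' _ _ enorm_ne_top]
    refine lintegral_mono fun y => ?_
    rw [enorm_mul, mul_left_comm]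
    gcongr
    rw [mul_comm, hGdef]
    simp only [← ofReal_norm, ← ENNReal.ofReal_mul (norm_nonneg _)]
    exact ENNReal.ofReal_le_ofReal (norm_inner_le_norm _ _)
  have hmeas3 : Measurable (fun p : (E2 × ℝ) × E2 =>
      ‖ρ.normed volume (p.1.1 + p.1.2 • v - p.2)‖ₑ * G p.2) := by
    refine Measurable.mul (Measurable.enorm ?_) (hG.comp measurable_snd)
    exact ρ.continuous_normed.measurable.comp (by fun_prop)
  have hmeas2 : Measurable (fun p : E2 × ℝ =>
      ‖v‖ₑ * ∫⁻ y, ‖ρ.normed volume (p.1 + p.2 • v - y)‖ₑ * G y) :=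
    (hmeas3.lintegral_prod_right').const_mul _
  calc ∫⁻ x in s, ‖F (x + v) - F x‖ₑ
      ≤ ∫⁻ x in s, ∫⁻ t in Set.Ioc (0 : ℝ) 1,
          ‖v‖ₑ * ∫⁻ y, ‖ρ.normed volume (x + t • v - y)‖ₑ * G y :=
        setLIntegral_mono' hsm hpt
    _ ≤ ∫⁻ x, ∫⁻ t in Set.Ioc (0 : ℝ) 1,
          ‖v‖ₑ * ∫⁻ y, ‖ρ.normed volume (x + t • v - y)‖ₑ * G y :=
        setLIntegral_le_lintegral _ _
    _ = ∫⁻ t in Set.Ioc (0 : ℝ) 1, ∫⁻ x,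
          ‖v‖ₑ * ∫⁻ y, ‖ρ.normed volume (x + t • v - y)‖ₑ * G y :=
        lintegral_lintegral_swap hmeas2.aemeasurable
    _ = ∫⁻ _ in Set.Ioc (0 : ℝ) 1, ‖v‖ₑ * ∫⁻ y, G y := by
        refine lintegral_congr fun t => ?_
        rw [lintegral_const_mul' _ _ enorm_ne_top,
          lintegral_add_right_eq_self
            (fun x => ∫⁻ y, ‖ρ.normed volume (x - y)‖ₑ * G y) (t • v),
          lintegral_mollified_le ρ hG]
    _ = ‖v‖ₑ * ∫⁻ y in closedBall x₀ R, ‖g y‖ₑ := by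
        rw [setLIntegral_const, Real.volume_Ioc]
        simp only [sub_zero, ENNReal.ofReal_one, mul_one]
        rw [← lintegral_indicator measurableSet_closedBall]
        simp only [hGdef, enorm_indicator_eq_indicator_enorm]

end Mollification

section Poincare

open Filter Topology Metric
open scoped ENNReal Convolution

variable {Ω : Set E2} {f : E2 → ℝ} {g : E2 → E2} {x₀ : E2} {r R : ℝ}

/-- The estimate for translations without mollification, by Fatou's lemma along a sequence of
shrinking mollifiers. -/
lemma lintegral_translate_sub_le (hr : 0 < r) (hR : closedBall x₀ (4 * r) ⊆ Ω)
    (h : IsWeakGrad Ω f g) (hg : Measurable g) {v : E2} (hv : ‖v‖ ≤ 2 * r) :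
    ∫⁻ x in ball x₀ r, ‖(closedBall x₀ (4 * r)).indicator f (x + v)
        - (closedBall x₀ (4 * r)).indicator f x‖ₑ
      ≤ ‖v‖ₑ * ∫⁻ y in closedBall x₀ (4 * r), ‖g y‖ₑ := by
  let ρ : ℕ → ContDiffBump (0 : E2) := fun n =>
    { rIn := r / (2 * (n + 2))
      rOut := r / (n + 2)
      rIn_pos := by positivity
      rIn_lt_rOut := by
        apply div_lt_div_of_pos_left hr (by positivity)
        have : (0 : ℝ) < n + 2 := by positivity
        linarith }
  have hrout : ∀ n, (ρ n).rOut = r / (n + 2) := fun n => rfl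
  have hrin : ∀ n, (ρ n).rIn = r / (2 * (n + 2)) := fun n => rfl
  have hroutle : ∀ n, (ρ n).rOut ≤ r := fun n => by
    rw [hrout]
    apply div_le_self hr.le
    have : (0 : ℝ) ≤ n := by positivity
    linarith
  have hlim : Tendsto (fun n => (ρ n).rOut) atTop (𝓝 0) := by
    simp only [hrout]
    exact tendsto_const_nhds.div_atTop
      (tendsto_atTop_add_const_right _ _ tendsto_natCast_atTop_atTop)
  have hfi : Integrable ((closedBall x₀ (4 * r)).indicator f) :=
    (h.1.integrableOn_compact_subset hR (isCompact_closedBall _ _)).integrable_indicator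
      measurableSet_closedBall
  set F : ℕ → E2 → ℝ := fun n => (ρ n).normed volume ⋆[ContinuousLinearMap.lsmul ℝ ℝ, volume]
          (closedBall x₀ (4 * r)).indicator f with hF
  have hFs : ∀ n, Continuous (F n) := fun n =>
    ((ρ n).hasCompactSupport_normed.contDiff_convolution_left (n := 0) _ (ρ n).contDiff_normed
      hfi.locallyIntegrable).continuous
  have hconv : ∀ᵐ x, Tendsto (fun n => F n x) atTop
      (𝓝 ((closedBall x₀ (4 * r)).indicator f x)) :=
    ContDiffBump.ae_convolution_tendsto_right_of_locallyIntegrable (K := 2) hlim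
      (Eventually.of_forall fun n => by
        rw [hrout, hrin]
        apply le_of_eq
        field_simp) hfi.locallyIntegrable
  have hconv' : ∀ᵐ x, Tendsto (fun n => F n (x + v)) atTop
      (𝓝 ((closedBall x₀ (4 * r)).indicator f (x + v))) :=
    (measurePreserving_add_right volume v).quasiMeasurePreserving.ae hconv
  have hbound : ∀ n, ∫⁻ x in ball x₀ r, ‖F n (x + v) - F n x‖ₑ
      ≤ ‖v‖ₑ * ∫⁻ y in closedBall x₀ (4 * r), ‖g y‖ₑ := by
    intro n
    refine lintegral_translate_mollified_le hR h hg (ρ n) v ?_ measurableSet_ball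
    intro x hx t ht
    apply closedBall_subset_closedBall'
    have h1 : dist (x + t • v) x₀ ≤ r + 2 * r := by
      rw [dist_eq_norm, add_sub_right_comm]
      refine (norm_add_le _ _).trans (add_le_add (mem_ball_iff_norm.1 hx).le ?_)
      rw [norm_smul, Real.norm_of_nonneg ht.1]
      nlinarith [ht.1, ht.2, norm_nonneg v]
    linarith [hroutle n]
  calc ∫⁻ x in ball x₀ r, ‖(closedBall x₀ (4 * r)).indicator f (x + v)
        - (closedBall x₀ (4 * r)).indicator f x‖ₑ
      = ∫⁻ x in ball x₀ r, liminf (fun n => ‖F n (x + v) - F n x‖ₑ) atTop := by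
        refine lintegral_congr_ae (ae_restrict_of_ae ?_)
        filter_upwards [hconv, hconv'] with x h1 h2
        exact ((h2.sub h1).enorm).liminf_eq.symm
    _ ≤ liminf (fun n => ∫⁻ x in ball x₀ r, ‖F n (x + v) - F n x‖ₑ) atTop := by
        refine lintegral_liminf_le fun n => ?_
        exact (((hFs n).comp (continuous_id.add continuous_const)).sub (hFs n)).measurable.enorm
    _ ≤ ‖v‖ₑ * ∫⁻ y in closedBall x₀ (4 * r), ‖g y‖ₑ := by
        refine (liminf_le_liminf (Eventually.of_forall hbound)).trans ?_
        rw [liminf_const]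

/-- The Poincaré inequality on a small ball: up to a constant, the `L¹` norm of a function is
controlled by that of its gradient. It follows from averaging the estimate for translations. -/
lemma exists_lintegral_sub_const_le (hr : 0 < r) (hR : closedBall x₀ (4 * r) ⊆ Ω) :
    ∃ C : ℝ≥0∞, C ≠ ∞ ∧ ∀ (f : E2 → ℝ) (g : E2 → E2), IsWeakGrad Ω f g →
      ∃ c : ℝ, ∫⁻ x in ball x₀ r, ‖f x - c‖ₑ ≤ C * ∫⁻ x in Ω, ‖g x‖ₑ := by
  have hBpos : volume (ball x₀ r) ≠ 0 := (measure_ball_pos _ _ hr).ne'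
  have hBfin : volume (ball x₀ r) ≠ ∞ := measure_ball_lt_top.ne
  refine ⟨(volume (ball x₀ r))⁻¹ * (ENNReal.ofReal (2 * r) *
    volume (closedBall (0 : E2) (2 * r))), ?_, ?_⟩
  · exact ENNReal.mul_ne_top (ENNReal.inv_ne_top.2 hBpos)
      (ENNReal.mul_ne_top ENNReal.ofReal_ne_top measure_closedBall_lt_top.ne)
  intro f₀ g₀ h₀
  -- measurable representatives make the Tonelli exchanges below possible
  obtain ⟨g, hgm, hg⟩ : ∃ g, Measurable g ∧ g₀ =ᵐ[volume.restrict Ω] g :=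
    ⟨_, h₀.2.1.aestronglyMeasurable.stronglyMeasurable_mk.measurable,
      h₀.2.1.aestronglyMeasurable.ae_eq_mk⟩
  obtain ⟨f, hfm, hf⟩ : ∃ f, Measurable f ∧ f₀ =ᵐ[volume.restrict Ω] f :=
    ⟨_, h₀.1.aestronglyMeasurable.stronglyMeasurable_mk.measurable,
      h₀.1.aestronglyMeasurable.ae_eq_mk⟩
  have h : IsWeakGrad Ω f g := h₀.congr hf hg
  have hBΩ : ball x₀ r ⊆ Ω :=
    (ball_subset_closedBall.trans (closedBall_subset_closedBall (by linarith))).trans hR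
  set K := closedBall x₀ (4 * r)
  set I := ∫⁻ x in Ω, ‖g x‖ₑ with hI
  have hgI : ∫⁻ x in Ω, ‖g₀ x‖ₑ = I :=
    lintegral_congr_ae (by filter_upwards [hg] with x hx; rw [hx])
  set k := K.indicator f with hk
  have hkm : Measurable k := hfm.indicator measurableSet_closedBall
  -- for `x`, `y` in the ball, `x = y + v` with `‖v‖ ≤ 2 r`; integrate the estimate over these `v`
  have hdouble : ∫⁻ y in ball x₀ r, ∫⁻ x in ball x₀ r, ‖k x - k y‖ₑ
      ≤ ENNReal.ofReal (2 * r) * volume (closedBall (0 : E2) (2 * r)) * I := by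
    have hm : Measurable (fun p : E2 × E2 => ‖k (p.1 + p.2) - k p.1‖ₑ) :=
      ((hkm.comp (measurable_fst.add measurable_snd)).sub (hkm.comp measurable_fst)).enorm
    calc ∫⁻ y in ball x₀ r, ∫⁻ x in ball x₀ r, ‖k x - k y‖ₑ
        ≤ ∫⁻ y in ball x₀ r, ∫⁻ v in closedBall (0 : E2) (2 * r), ‖k (y + v) - k y‖ₑ := by
          refine setLIntegral_mono' measurableSet_ball fun y hy => ?_
          rw [← lintegral_indicator measurableSet_ball,
            ← lintegral_add_left_eq_self _ y, ← lintegral_indicator measurableSet_closedBall]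
          refine lintegral_mono fun v => ?_
          by_cases hv : y + v ∈ ball x₀ r
          · have hv' : v ∈ closedBall (0 : E2) (2 * r) := by
              rw [mem_closedBall_zero_iff]
              have h1 := mem_ball_iff_norm.1 hv
              have h2 := mem_ball_iff_norm.1 hy
              have : v = (y + v - x₀) - (y - x₀) := by abel
              rw [this]
              refine (norm_sub_le _ _).trans (by linarith)
            rw [Set.indicator_of_mem hv, Set.indicator_of_mem hv']
          · rw [Set.indicator_of_notMem hv]
            exact zero_le
      _ = ∫⁻ v in closedBall (0 : E2) (2 * r), ∫⁻ y in ball x₀ r, ‖k (y + v) - k y‖ₑ :=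
          lintegral_lintegral_swap hm.aemeasurable
      _ ≤ ∫⁻ _ in closedBall (0 : E2) (2 * r), ENNReal.ofReal (2 * r) * I := by
          refine setLIntegral_mono' measurableSet_closedBall fun v hv => ?_
          have hv' := mem_closedBall_zero_iff.1 hv
          refine (lintegral_translate_sub_le hr hR h hgm hv').trans ?_
          refine mul_le_mul' ?_ (lintegral_mono_set hR)
          rw [← ofReal_norm]
          exact ENNReal.ofReal_le_ofReal hv'
      _ = ENNReal.ofReal (2 * r) * volume (closedBall (0 : E2) (2 * r)) * I := by
          rw [setLIntegral_const]
          ring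
  have hm' : AEMeasurable (fun y => ∫⁻ x in ball x₀ r, ‖k x - k y‖ₑ)
      (volume.restrict (ball x₀ r)) := by
    have : Measurable (fun p : E2 × E2 => ‖k p.2 - k p.1‖ₑ) :=
      ((hkm.comp measurable_snd).sub (hkm.comp measurable_fst)).enorm
    exact (this.lintegral_prod_right').aemeasurable
  -- the constant is the value of `k` at a point `y` where the inner integral is at most its mean
  obtain ⟨y, hyB, hy⟩ := exists_le_setLAverage hBpos hBfin hm'
  refine ⟨k y, ?_⟩
  have e1 : ∫⁻ x in ball x₀ r, ‖f₀ x - k y‖ₑ = ∫⁻ x in ball x₀ r, ‖k x - k y‖ₑ := by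
    refine lintegral_congr_ae ?_
    filter_upwards [ae_restrict_of_ae_restrict_of_subset hBΩ hf,
      ae_restrict_mem measurableSet_ball] with x hx hxB
    rw [hx, hk, Set.indicator_of_mem (ball_subset_closedBall.trans
      (closedBall_subset_closedBall (by linarith)) hxB)]
  rw [e1, hgI]
  refine hy.trans ?_
  rw [setLAverage_eq, ENNReal.div_eq_inv_mul, mul_assoc]
  gcongr

end Poincare

/-! ### Gradients on a connected open set -/

section Gradients

open Filter Topology Metric
open scoped ENNReal

variable {Ω : Set E2} {f : E2 → ℝ} {g : E2 → E2} {x₀ : E2} {r R : ℝ}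

lemma exists_closedBall_four_mul_subset (hΩ : IsOpen Ω) {x : E2} (hx : x ∈ Ω) :
    ∃ r : ℝ, 0 < r ∧ closedBall x (4 * r) ⊆ Ω := by
  obtain ⟨ε, hε, h⟩ := Metric.nhds_basis_closedBall.mem_iff.1 (hΩ.mem_nhds hx)
  exact ⟨ε / 4, by positivity, by rwa [mul_div_cancel₀ _ (by norm_num)]⟩

lemma ae_restrict_of_locally {p : E2 → Prop}
    (h : ∀ x ∈ Ω, ∃ ρ > 0, ∀ᵐ y ∂volume.restrict (ball x ρ), p y)
    (hΩ : IsOpen Ω) : ∀ᵐ y ∂volume.restrict Ω, p y := by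
  rw [ae_restrict_iff' hΩ.measurableSet]
  have : volume {x | ¬ (x ∈ Ω → p x)} = 0 := by
    refine measure_null_of_locally_null _ fun x hx => ?_
    have hxΩ : x ∈ Ω := by
      by_contra h'
      exact hx fun h'' => absurd h'' h'
    obtain ⟨ρ, hρ, hp⟩ := h x hxΩ
    rw [ae_restrict_iff' measurableSet_ball] at hp
    refine ⟨_, inter_mem_nhdsWithin _ (ball_mem_nhds x hρ), measure_mono_null ?_ hp⟩
    rintro y ⟨hy, hyb⟩ h'
    exact hy fun _ => h' hyb
  exact this

lemma IsWeakGrad.aestronglyMeasurable_restrict (h : IsWeakGrad Ω f g) {s : Set E2} (hs : s ⊆ Ω) :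
    AEStronglyMeasurable f (volume.restrict s) :=
  h.1.aestronglyMeasurable.mono_set hs

/-- Near every point of a connected open set, a function is controlled by its gradient and by its
values on a fixed ball, since the set of points with this property is open and closed in `Ω`. -/
lemma exists_lintegral_ball_le (hΩ : IsOpen Ω) (hc : IsConnected Ω) (hx₀ : x₀ ∈ Ω) (hr : 0 < r)
    {x : E2} (hx : x ∈ Ω) : ∃ ρ > 0, ball x ρ ⊆ Ω ∧ ∃ C : ℝ≥0∞, C ≠ ∞ ∧
      ∀ (f : E2 → ℝ) (g : E2 → E2), IsWeakGrad Ω f g →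
        ∫⁻ y in ball x ρ, ‖f y‖ₑ ≤ C * ((∫⁻ y in ball x₀ r, ‖f y‖ₑ) + ∫⁻ y in Ω, ‖g y‖ₑ) := by
  set S : Set E2 := {x | ∃ ρ > 0, ball x ρ ⊆ Ω ∧ ∃ C : ℝ≥0∞, C ≠ ∞ ∧
      ∀ (f : E2 → ℝ) (g : E2 → E2), IsWeakGrad Ω f g →
        ∫⁻ y in ball x ρ, ‖f y‖ₑ ≤ C * ((∫⁻ y in ball x₀ r, ‖f y‖ₑ) + ∫⁻ y in Ω, ‖g y‖ₑ)}
    with hS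
  have hSo : IsOpen S := by
    rw [Metric.isOpen_iff]
    rintro x ⟨ρ, hρ, hsub, C, hC, h⟩
    refine ⟨ρ, hρ, fun y hy => ?_⟩
    have hsub' : ball y (ρ - dist y x) ⊆ ball x ρ := ball_subset_ball' (by linarith)
    refine ⟨ρ - dist y x, by have := mem_ball.1 hy; linarith, hsub'.trans hsub, C, hC,
      fun f g hfg => ?_⟩
    exact (lintegral_mono_set hsub').trans (h f g hfg)
  have hx₀S : x₀ ∈ S := by
    obtain ⟨ε, hε, h⟩ := Metric.isOpen_iff.1 hΩ x₀ hx₀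
    refine ⟨min ε r, by positivity, (ball_subset_ball (min_le_left _ _)).trans h, 1, by simp,
      fun f g _ => ?_⟩
    rw [one_mul]
    exact (lintegral_mono_set (ball_subset_ball (min_le_right _ _))).trans le_self_add
  refine hc.isPreconnected.subset_of_closure_inter_subset hSo ⟨x₀, hx₀, hx₀S⟩ ?_ hx
  -- a point `y` of the closure has a ball that meets a good ball around some `z`; the Poincaré
  -- constant `c` on the ball of `y` is controlled through the values of `f` on the overlap
  rintro y ⟨hyS, hyΩ⟩
  obtain ⟨s, hs, hsub⟩ := exists_closedBall_four_mul_subset hΩ hyΩ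
  obtain ⟨C₁, hC₁, hP⟩ := exists_lintegral_sub_const_le hs hsub
  obtain ⟨z, hzS, hz⟩ := Metric.mem_closure_iff.1 hyS s hs
  obtain ⟨ρ, hρ, hρΩ, C, hC, h⟩ := hzS
  have hBΩ : ball y s ⊆ Ω :=
    (ball_subset_closedBall.trans (closedBall_subset_closedBall (by linarith))).trans hsub
  set ρ' := min ρ (s - dist z y) with hρ'
  have hρ'pos : 0 < ρ' := lt_min hρ (by rw [dist_comm]; linarith)
  have hb1 : ball z ρ' ⊆ ball z ρ := ball_subset_ball (min_le_left _ _)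
  have hb2 : ball z ρ' ⊆ ball y s := ball_subset_ball' (by
    have := min_le_right ρ (s - dist z y)
    linarith)
  have hv0 : volume (ball z ρ') ≠ 0 := (measure_ball_pos _ _ hρ'pos).ne'
  have hv1 : volume (ball z ρ') ≠ ∞ := measure_ball_lt_top.ne
  refine ⟨s, hs, hBΩ, C₁ + (C₁ + C) / volume (ball z ρ') * volume (ball y s), ?_,
    fun f g hfg => ?_⟩
  · exact ENNReal.add_ne_top.2 ⟨hC₁, ENNReal.mul_ne_top (ENNReal.div_ne_top
      (ENNReal.add_ne_top.2 ⟨hC₁, hC⟩) hv0) measure_ball_lt_top.ne⟩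
  obtain ⟨c, hc⟩ := hP f g hfg
  have h' := h f g hfg
  set A := ∫⁻ y in ball x₀ r, ‖f y‖ₑ
  set I := ∫⁻ y in Ω, ‖g y‖ₑ
  have hcb : ‖c‖ₑ ≤ (C₁ + C) / volume (ball z ρ') * (A + I) := by
    rw [← ENNReal.mul_div_right_comm, ENNReal.le_div_iff_mul_le (Or.inl hv0) (Or.inl hv1)]
    calc ‖c‖ₑ * volume (ball z ρ') = ∫⁻ _ in ball z ρ', ‖c‖ₑ := (setLIntegral_const _ _).symm
      _ ≤ ∫⁻ x in ball z ρ', (‖f x‖ₑ + ‖f x - c‖ₑ) := lintegral_mono fun x => by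
          have : c = f x - (f x - c) := by ring
          calc ‖c‖ₑ = ‖f x - (f x - c)‖ₑ := by rw [← this]
            _ ≤ _ := enorm_sub_le
      _ = (∫⁻ x in ball z ρ', ‖f x‖ₑ) + ∫⁻ x in ball z ρ', ‖f x - c‖ₑ :=
          lintegral_add_left' (hfg.aestronglyMeasurable_restrict (hb2.trans hBΩ)).enorm _
      _ ≤ C * (A + I) + C₁ * I :=
          add_le_add ((lintegral_mono_set hb1).trans h') ((lintegral_mono_set hb2).trans hc)
      _ ≤ C * (A + I) + C₁ * (A + I) := by gcongr; exact le_add_self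
      _ = (C₁ + C) * (A + I) := by ring
  calc ∫⁻ x in ball y s, ‖f x‖ₑ ≤ ∫⁻ x in ball y s, (‖f x - c‖ₑ + ‖c‖ₑ) :=
        lintegral_mono fun x => by
          calc ‖f x‖ₑ = ‖(f x - c) + c‖ₑ := by rw [sub_add_cancel]
            _ ≤ _ := enorm_add_le _ _
    _ = (∫⁻ x in ball y s, ‖f x - c‖ₑ) + ‖c‖ₑ * volume (ball y s) := by
        rw [lintegral_add_right _ measurable_const, setLIntegral_const]
    _ ≤ C₁ * (A + I) + (C₁ + C) / volume (ball z ρ') * (A + I) * volume (ball y s) := by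
        gcongr
        exact hc.trans (by gcongr; exact le_add_self)
    _ = _ := by ring

/-- On a connected open set, a function with mean zero over a suitable fixed ball is controlled
locally by its gradient. -/
lemma exists_normalized_lintegral_ball_le (hΩ : IsOpen Ω) (hc : IsConnected Ω) :
    ∃ B : Set E2, volume B ≠ 0 ∧ volume B ≠ ∞ ∧
      (∀ (f : E2 → ℝ) (g : E2 → E2), IsWeakGrad Ω f g → IntegrableOn f B) ∧
      ∀ x ∈ Ω, ∃ ρ > 0, ball x ρ ⊆ Ω ∧ ∃ C : ℝ≥0∞, C ≠ ∞ ∧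
      ∀ (f : E2 → ℝ) (g : E2 → E2), IsWeakGrad Ω f g → ∫ y in B, f y = 0 →
        ∫⁻ y in ball x ρ, ‖f y‖ₑ ≤ C * ∫⁻ y in Ω, ‖g y‖ₑ := by
  obtain ⟨x₀, hx₀⟩ := hc.nonempty
  obtain ⟨r, hr, hsub⟩ := exists_closedBall_four_mul_subset hΩ hx₀
  obtain ⟨C₁, hC₁, hP⟩ := exists_lintegral_sub_const_le hr hsub
  have hint : ∀ (f : E2 → ℝ) (g : E2 → E2), IsWeakGrad Ω f g → IntegrableOn f (ball x₀ r) := by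
    intro f g hfg
    exact (hfg.1.integrableOn_compact_subset hsub (isCompact_closedBall _ _)).mono_set
      (ball_subset_closedBall.trans (closedBall_subset_closedBall (by linarith)))
  have hv0 : volume (ball x₀ r) ≠ 0 := (measure_ball_pos _ _ hr).ne'
  have hv1 : volume (ball x₀ r) ≠ ∞ := measure_ball_lt_top.ne
  refine ⟨ball x₀ r, hv0, hv1, hint, fun x hx => ?_⟩
  obtain ⟨ρ, hρ, hρΩ, C, hC, h⟩ := exists_lintegral_ball_le hΩ hc hx₀ hr hx
  refine ⟨ρ, hρ, hρΩ, C * (C₁ + C₁ + 1), ENNReal.mul_ne_top hC (by finiteness),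
    fun f g hfg h0 => ?_⟩
  refine (h f g hfg).trans ?_
  rw [mul_assoc]
  gcongr
  rw [add_mul, one_mul]
  gcongr
  obtain ⟨c, hc'⟩ := hP f g hfg
  set I := ∫⁻ y in Ω, ‖g y‖ₑ
  have hfi := hint f g hfg
  -- as `f` has mean zero, `c` is the negative of the mean of `f - c`
  have hcb : ‖c‖ₑ * volume (ball x₀ r) ≤ C₁ * I := by
    have e : ∫ y in ball x₀ r, (f y - c) = -(volume.real (ball x₀ r) * c) := by
      rw [integral_sub hfi (integrableOn_const hv1), h0, setIntegral_const, smul_eq_mul, zero_sub]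
    have e2 : ‖∫ y in ball x₀ r, (f y - c)‖ₑ = ‖c‖ₑ * volume (ball x₀ r) := by
      rw [e, enorm_neg, enorm_mul, mul_comm, Measure.real, Real.enorm_of_nonneg ENNReal.toReal_nonneg,
        ENNReal.ofReal_toReal hv1]
    rw [← e2]
    exact (enorm_integral_le_lintegral_enorm _).trans hc'
  calc ∫⁻ x in ball x₀ r, ‖f x‖ₑ ≤ ∫⁻ x in ball x₀ r, (‖f x - c‖ₑ + ‖c‖ₑ) :=
        lintegral_mono fun x => by
          calc ‖f x‖ₑ = ‖(f x - c) + c‖ₑ := by rw [sub_add_cancel]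
            _ ≤ _ := enorm_add_le _ _
    _ = (∫⁻ x in ball x₀ r, ‖f x - c‖ₑ) + ‖c‖ₑ * volume (ball x₀ r) := by
        rw [lintegral_add_right _ measurable_const, setLIntegral_const]
    _ ≤ C₁ * I + C₁ * I := add_le_add hc' hcb
    _ = (C₁ + C₁) * I := by ring

lemma exists_sub_const_integral_eq_zero {B : Set E2} (h0 : volume B ≠ 0) (h1 : volume B ≠ ∞)
    (hf : IntegrableOn f B) : ∃ c : ℝ, ∫ y in B, (f y - c) = 0 := by
  refine ⟨(volume.real B)⁻¹ * ∫ y in B, f y, ?_⟩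
  have : volume.real B ≠ 0 := (ENNReal.toReal_pos h0 h1).ne'
  rw [integral_sub hf (integrableOn_const h1), setIntegral_const, smul_eq_mul,
    mul_inv_cancel_left₀ this, sub_self]

/-- A function with vanishing weak gradient on a connected open set is constant. -/
lemma IsWeakGrad.ae_const_of_zero (hΩ : IsOpen Ω) (hc : IsConnected Ω)
    (h : IsWeakGrad Ω f (fun _ => 0)) : ∃ c : ℝ, ∀ᵐ x ∂volume.restrict Ω, f x = c := by
  obtain ⟨B, h0, h1, hint, hB⟩ := exists_normalized_lintegral_ball_le hΩ hc
  obtain ⟨c, hc⟩ := exists_sub_const_integral_eq_zero h0 h1 (hint f _ h)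
  have h' : IsWeakGrad Ω (fun x => f x - c) (fun _ => 0) := by
    simpa using h.sub (isWeakGrad_const c)
  refine ⟨c, ae_restrict_of_locally (fun x hx => ?_) hΩ⟩
  obtain ⟨ρ, hρ, hρΩ, C, -, hC⟩ := hB x hx
  refine ⟨ρ, hρ, ?_⟩
  have := hC _ _ h' hc
  simp only [enorm_zero, lintegral_zero, mul_zero, nonpos_iff_eq_zero] at this
  rw [lintegral_eq_zero_iff' (h'.aestronglyMeasurable_restrict hρΩ).enorm] at this
  filter_upwards [this] with y hy
  exact sub_eq_zero.1 (by simpa using hy)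

/-- Convergence in `L¹` on the support of `η` allows passing to the limit in pairings with `η`. -/
lemma IsTest.tendsto_integral_mul {u : ℕ → E2 → ℝ} {u₀ η : E2 → ℝ}
    (hu : ∀ n, LocallyIntegrableOn (u n) Ω)
    (hu₀ : LocallyIntegrableOn u₀ Ω) (hη : Continuous η) (hηc : HasCompactSupport η)
    (hηs : tsupport η ⊆ Ω)
    (hlim : Tendsto (fun n => ∫⁻ x in tsupport η, ‖u n x - u₀ x‖ₑ) atTop (𝓝 0)) :
    Tendsto (fun n => ∫ x in Ω, η x * u n x) atTop (𝓝 (∫ x in Ω, η x * u₀ x)) := by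
  obtain ⟨M, hM⟩ := hη.bounded_above_of_compact_support hηc
  refine tendsto_integral_of_L1 _
    (integrable_smul_of_tsupport_subset hu₀ hη hηc hηs).integrableOn.aestronglyMeasurable
    (Eventually.of_forall fun n =>
      (integrable_smul_of_tsupport_subset (hu n) hη hηc hηs).integrableOn) ?_
  refine tendsto_of_tendsto_of_tendsto_of_le_of_le tendsto_const_nhds
    (h := fun n => ENNReal.ofReal M * ∫⁻ x in tsupport η, ‖u n x - u₀ x‖ₑ) ?_
    (fun _ => zero_le) (fun n => ?_)
  · have := ENNReal.Tendsto.const_mul (a := ENNReal.ofReal M) hlim (Or.inr ENNReal.ofReal_ne_top)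
    rwa [mul_zero] at this
  · calc ∫⁻ x in Ω, ‖η x * u n x - η x * u₀ x‖ₑ
        ≤ ∫⁻ x, ‖η x * u n x - η x * u₀ x‖ₑ := setLIntegral_le_lintegral _ _
      _ ≤ ∫⁻ x, (tsupport η).indicator
            (fun x => ENNReal.ofReal M * ‖u n x - u₀ x‖ₑ) x := by
          refine lintegral_mono fun x => ?_
          by_cases hx : x ∈ tsupport η
          · rw [Set.indicator_of_mem hx, ← mul_sub, enorm_mul, ← ofReal_norm (η x)]
            gcongr
            exact hM x
          · simp [image_eq_zero_of_notMem_tsupport hx]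
      _ = _ := by
          rw [lintegral_indicator (isClosed_tsupport η).measurableSet,
            lintegral_const_mul' _ _ ENNReal.ofReal_ne_top]

/-- A limit in `L¹(Ω)` of gradients is a gradient, when the domain is connected. -/
lemma exists_isWeakGrad_of_tendsto (hΩ : IsOpen Ω) (hc : IsConnected Ω)
    {F : ℕ → E2 → ℝ} {G : ℕ → E2 → E2} (hF : ∀ n, IsWeakGrad Ω (F n) (G n))
    (hg : LocallyIntegrableOn g Ω)
    (hlim : ∀ n, ∫⁻ x in Ω, ‖G n x - g x‖ₑ ≤ 2⁻¹ ^ n) : ∃ f, IsWeakGrad Ω f g := by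
  obtain ⟨B, h0, h1, hint, hB⟩ := exists_normalized_lintegral_ball_le hΩ hc
  choose c hc using fun n => exists_sub_const_integral_eq_zero h0 h1 (hint _ _ (hF n))
  -- normalized to mean zero on `B`, the primitives are Cauchy in `L¹` near every point of `Ω`
  set u : ℕ → E2 → ℝ := fun n x => F n x - c n with hu
  have hug : ∀ n, IsWeakGrad Ω (u n) (G n) := fun n => by
    simpa using (hF n).sub (isWeakGrad_const (c n))
  have hgm : AEStronglyMeasurable g (volume.restrict Ω) := hg.aestronglyMeasurable
  have hdiff : ∀ N n m : ℕ, N ≤ n → N ≤ m →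
      ∫⁻ x in Ω, ‖G n x - G m x‖ₑ ≤ 2 * 2⁻¹ ^ N := by
    intro N n m hn hm
    calc ∫⁻ x in Ω, ‖G n x - G m x‖ₑ
        ≤ ∫⁻ x in Ω, (‖G n x - g x‖ₑ + ‖G m x - g x‖ₑ) := lintegral_mono fun x => by
          calc ‖G n x - G m x‖ₑ = ‖(G n x - g x) - (G m x - g x)‖ₑ := by congr 1; abel
            _ ≤ _ := enorm_sub_le
      _ = (∫⁻ x in Ω, ‖G n x - g x‖ₑ) + ∫⁻ x in Ω, ‖G m x - g x‖ₑ :=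
          lintegral_add_left' ((hF n).2.1.aestronglyMeasurable.sub hgm).enorm _
      _ ≤ 2⁻¹ ^ n + 2⁻¹ ^ m := add_le_add (hlim n) (hlim m)
      _ ≤ 2⁻¹ ^ N + 2⁻¹ ^ N :=
          add_le_add (pow_le_pow_right_of_le_one' (by simp) hn) (pow_le_pow_right_of_le_one' (by simp) hm)
      _ = 2 * 2⁻¹ ^ N := by ring
  choose! ρ hρ hρΩ C hC hCle using hB
  have hcau : ∀ x ∈ Ω, ∀ N n m : ℕ, N ≤ n → N ≤ m →
      eLpNorm (u n - u m) 1 (volume.restrict (ball x (ρ x)))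
        < (C x + 1) * (2 * 2⁻¹ ^ N) := by
    intro x hx N n m hn hm
    rw [eLpNorm_one_eq_lintegral_enorm]
    have hz : ∫ y in B, (u n y - u m y) = 0 := by
      rw [integral_sub (hint _ _ (hug n)) (hint _ _ (hug m))]
      simp only [hu, hc, sub_zero]
    have hpos : (2 * 2⁻¹ ^ N : ℝ≥0∞) ≠ 0 := by simp
    have hfin : (2 * 2⁻¹ ^ N : ℝ≥0∞) ≠ ∞ :=
      ENNReal.mul_ne_top (by simp) (ENNReal.pow_ne_top (by simp))
    calc ∫⁻ y in ball x (ρ x), ‖(u n - u m) y‖ₑ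
        ≤ C x * ∫⁻ y in Ω, ‖G n y - G m y‖ₑ :=
          hCle x hx _ _ ((hug n).sub (hug m)) hz
      _ ≤ C x * (2 * 2⁻¹ ^ N) := by gcongr; exact hdiff N n m hn hm
      _ < (C x + 1) * (2 * 2⁻¹ ^ N) := by
          refine ENNReal.mul_lt_mul_left hpos hfin ?_
          exact ENNReal.lt_add_right (hC x hx) one_ne_zero
  have hsum : ∀ x ∈ Ω, ∑' N : ℕ, (C x + 1) * (2 * 2⁻¹ ^ N) ≠ ∞ := by
    intro x hx
    rw [ENNReal.tsum_mul_left, ENNReal.tsum_mul_left, ENNReal.tsum_geometric]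
    have := hC x hx
    refine ENNReal.mul_ne_top (by finiteness) (ENNReal.mul_ne_top (by simp) ?_)
    simp
  have hum : ∀ x ∈ Ω, ∀ n, AEStronglyMeasurable (u n) (volume.restrict (ball x (ρ x))) :=
    fun x hx n => (hug n).aestronglyMeasurable_restrict (hρΩ x hx)
  classical
  -- the pointwise limit is defined globally, so that the local limits need not be glued
  set f : E2 → ℝ := fun x =>
    if h : ∃ l, Tendsto (fun n => u n x) atTop (𝓝 l) then h.choose else 0 with hf
  have hae : ∀ x ∈ Ω, ∀ᵐ y ∂volume.restrict (ball x (ρ x)),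
      Tendsto (fun n => u n y) atTop (𝓝 (f y)) := by
    intro x hx
    filter_upwards [Lp.ae_tendsto_of_cauchy_eLpNorm (hum x hx) le_rfl (hsum x hx) (hcau x hx)]
      with y hy
    simp only [hf, dif_pos hy]
    exact hy.choose_spec
  have hL1 : ∀ x ∈ Ω, Tendsto (fun n => ∫⁻ y in ball x (ρ x), ‖u n y - f y‖ₑ) atTop (𝓝 0) := by
    intro x hx
    have := Lp.cauchy_tendsto_of_tendsto (hum x hx) f (hsum x hx) (hcau x hx) (hae x hx)
    simpa only [eLpNorm_one_eq_lintegral_enorm, Pi.sub_apply] using this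
  have hfm : ∀ x ∈ Ω, AEStronglyMeasurable f (volume.restrict (ball x (ρ x))) := fun x hx =>
    aestronglyMeasurable_of_tendsto_ae atTop (hum x hx) (hae x hx)
  have hfloc : LocallyIntegrableOn f Ω := by
    intro x hx
    obtain ⟨s, hs, hsub⟩ := exists_closedBall_four_mul_subset hΩ hx
    have hev := (hL1 x hx).eventually (gt_mem_nhds (zero_lt_one))
    obtain ⟨n, hn⟩ := hev.exists
    have hd : IntegrableOn (fun y => u n y - f y) (ball x (ρ x)) :=
      ⟨(hum x hx n).sub (hfm x hx), hn.trans ENNReal.one_lt_top⟩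
    have hun : IntegrableOn (u n) (closedBall x (4 * s)) :=
      (hug n).1.integrableOn_compact_subset hsub (isCompact_closedBall _ _)
    refine ⟨ball x (ρ x) ∩ closedBall x (4 * s), mem_nhdsWithin_of_mem_nhds
      (inter_mem (ball_mem_nhds _ (hρ x hx)) (closedBall_mem_nhds _ (by positivity))), ?_⟩
    have := (hun.mono_set Set.inter_subset_right).sub (hd.mono_set Set.inter_subset_left)
    have e : f = u n - fun y => u n y - f y := (sub_sub_cancel (u n) f).symm
    rw [e]
    exact this
  have hcpt : ∀ K : Set E2, IsCompact K → K ⊆ Ω →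
      Tendsto (fun n => ∫⁻ y in K, ‖u n y - f y‖ₑ) atTop (𝓝 0) := by
    intro K hK hKΩ
    refine hK.induction_on (p := fun s =>
      Tendsto (fun n => ∫⁻ y in s, ‖u n y - f y‖ₑ) atTop (𝓝 0)) ?_ ?_ ?_ ?_
    · simp
    · intro s t hst ht
      exact tendsto_of_tendsto_of_tendsto_of_le_of_le tendsto_const_nhds ht
        (fun _ => zero_le) (fun n => lintegral_mono_set hst)
    · intro s t hs ht
      have := hs.add ht
      rw [add_zero] at this
      exact tendsto_of_tendsto_of_tendsto_of_le_of_le tendsto_const_nhds this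
        (fun _ => zero_le) (fun n => lintegral_union_le _ _ _)
    · intro x hx
      exact ⟨ball x (ρ x), mem_nhdsWithin_of_mem_nhds (ball_mem_nhds _ (hρ x (hKΩ hx))),
        hL1 x (hKΩ hx)⟩
  refine ⟨f, hfloc, hg, fun ψ a b d v => ?_⟩
  have hψ : IsTest Ω ψ := ⟨a, b, d⟩
  have l1 := IsTest.tendsto_integral_mul (fun n => (hug n).1) hfloc (hψ.continuous_fderiv_apply v)
    (hψ.compact_fderiv_apply v) (hψ.support_fderiv_apply v)
    (hcpt _ (hψ.compact_fderiv_apply v) (hψ.support_fderiv_apply v))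
  have hinner : ∀ {k : E2 → E2}, LocallyIntegrableOn k Ω →
      LocallyIntegrableOn (fun x => inner ℝ (k x) v) Ω := fun {k} hk => by
    intro x hx
    obtain ⟨s, hs, hi⟩ := hk x hx
    exact ⟨s, hs, hi.inner_const (𝕜 := ℝ) v⟩
  have l2 := IsTest.tendsto_integral_mul (fun n => hinner (hF n).2.1) (hinner hg) hψ.continuous
    hψ.compact hψ.support (by
      refine tendsto_of_tendsto_of_tendsto_of_le_of_le tendsto_const_nhds
        (h := fun n : ℕ => ‖v‖ₑ * 2⁻¹ ^ n) ?_ (fun _ => zero_le) (fun n => ?_)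
      · have := ENNReal.Tendsto.const_mul (a := ‖v‖ₑ)
          (ENNReal.tendsto_pow_atTop_nhds_zero_of_lt_one (r := 2⁻¹) (by simp)) (Or.inr enorm_ne_top)
        rwa [mul_zero] at this
      · refine le_trans ?_ (mul_le_mul' le_rfl (hlim n))
        rw [← lintegral_const_mul' _ _ enorm_ne_top]
        refine le_trans (lintegral_mono fun x => ?_) (lintegral_mono_set hψ.support)
        rw [← inner_sub_left, mul_comm]
        simp only [← ofReal_norm, ← ENNReal.ofReal_mul (norm_nonneg _)]
        exact ENNReal.ofReal_le_ofReal (norm_inner_le_norm _ _))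
  have heq : ∀ n, ∫ x in Ω, fderiv ℝ ψ x v * u n x
      = -∫ x in Ω, ψ x * inner ℝ (G n x) v := fun n => by
    rw [← (hug n).identity hψ v]
    simp only [mul_comm]
  simp only [heq] at l1
  have := tendsto_nhds_unique l1 l2.neg
  rw [← this]
  simp only [mul_comm]

end Gradients

/-! ### The coupled linear problem -/

lemma exists_unique_of_isCoercive {X : Type*} [NormedAddCommGroup X] [InnerProductSpace ℝ X]
    [CompleteSpace X] {B : X →L[ℝ] X →L[ℝ] ℝ} (hB : IsCoercive B) (L : X →L[ℝ] ℝ) :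
    ∃ x, (∀ y, B x y = L y) ∧ ∀ x₂, (∀ y, B x₂ y = L y) → x₂ = x := by
  refine ⟨hB.continuousLinearEquivOfBilin.symm ((InnerProductSpace.toDual ℝ X).symm L),
    fun y => ?_, fun x₂ h₂ => ?_⟩
  · rw [← hB.continuousLinearEquivOfBilin_apply, ContinuousLinearEquiv.apply_symm_apply,
      InnerProductSpace.toDual_symm_apply]
  · rw [ContinuousLinearEquiv.eq_symm_apply]
    apply ext_inner_right ℝ
    intro y
    rw [hB.continuousLinearEquivOfBilin_apply, h₂, InnerProductSpace.toDual_symm_apply]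

section Coupled

variable {H V : Type*} [NormedAddCommGroup H] [InnerProductSpace ℝ H]
  [NormedAddCommGroup V] [InnerProductSpace ℝ V]

/-- The linear system of one time step in abstract form: `m` and `d` are the mass and stiffness
forms of the phase variables, `b` is the form of the velocity equation, and the functionals
`f`, `a`, `k`, `c` are the couplings to the scalar unknowns `r` and `q`. -/
structure IsCoupledSolution (m d : H →L[ℝ] H →L[ℝ] ℝ) (b : V →L[ℝ] V →L[ℝ] ℝ)
    (f a l : H →L[ℝ] ℝ) (k c l' : V →L[ℝ] ℝ) (β γ θ r₀ q₀ : ℝ)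
    (φ μ : H) (w : V) (r q : ℝ) : Prop where
  phi : ∀ χ, m φ χ + r * a χ + β * d μ χ = l χ
  mu : ∀ ψ, d φ ψ + γ * m φ ψ + r * f ψ = m μ ψ
  vel : ∀ v, b w v + q * c v - r * k v = l' v
  aux_r : 2 * r - (f φ + a μ - k w) = r₀
  aux_q : θ * q - c w = q₀

/-- The lower bound behind the coercivity of the coupled problem. The cross terms carry the factor
`κ`, so Young's inequality absorbs them once `κ` is small. -/
lemma exists_coupled_lower_bound (m d : H →L[ℝ] H →L[ℝ] ℝ) (f : H →L[ℝ] ℝ) {β γ : ℝ}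
    (hβ : 0 < β) (hγ : 0 < γ) (hm0 : ∀ x, 0 ≤ m x x) (hd0 : ∀ x, 0 ≤ d x x)
    (hmd : ∀ x, m x x + d x x = ‖x‖ ^ 2) :
    ∃ κ > 0, ∃ C > 0, ∀ (φ μ : H) (r : ℝ), C * (‖φ‖ ^ 2 + ‖μ‖ ^ 2 + r ^ 2)
      ≤ β * d μ μ + κ * m μ μ + (d φ φ + γ * m φ φ) - κ * (d φ μ + γ * m φ μ + r * f μ)
        + 2 * r ^ 2 := by
  set K : ℝ := ‖d‖ + γ * ‖m‖ + ‖f‖ + 1 with hK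
  have hKpos : 0 < K := by positivity
  set g : ℝ := min 1 γ with hg
  have hgpos : 0 < g := lt_min one_pos hγ
  have hg1 : g ≤ 1 := min_le_left _ _
  have hgγ : g ≤ γ := min_le_right _ _
  -- `κ ≤ β` bounds `β d μ μ + κ m μ μ` below by `κ ‖μ‖²`; `κ ≤ g / (2 K²)` absorbs the cross terms
  set κ : ℝ := min β (g / (2 * K ^ 2)) with hκ
  have hκpos : 0 < κ := lt_min hβ (by positivity)
  have hκβ : κ ≤ β := min_le_left _ _
  have hκK : κ * K ^ 2 ≤ g / 2 := by
    have : κ ≤ g / (2 * K ^ 2) := min_le_right _ _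
    rw [le_div_iff₀ (by positivity)] at this
    linarith
  refine ⟨κ, hκpos, min (g / 2) (κ / 2), by positivity, fun φ μ r => ?_⟩
  have e1 : |d φ μ + γ * m φ μ + r * f μ| ≤ K * (‖φ‖ + |r|) * ‖μ‖ := by
    have a1 : |d φ μ| ≤ ‖d‖ * ‖φ‖ * ‖μ‖ := d.le_opNorm₂ φ μ
    have a2 : |m φ μ| ≤ ‖m‖ * ‖φ‖ * ‖μ‖ := m.le_opNorm₂ φ μ
    have a3 : |f μ| ≤ ‖f‖ * ‖μ‖ := f.le_opNorm μ
    have a4 : |γ * m φ μ| ≤ γ * (‖m‖ * ‖φ‖ * ‖μ‖) := by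
      rw [abs_mul, abs_of_pos hγ]; gcongr
    have a5 : |r * f μ| ≤ |r| * (‖f‖ * ‖μ‖) := by rw [abs_mul]; gcongr
    have a6 : 0 ≤ ‖d‖ * |r| * ‖μ‖ + γ * ‖m‖ * |r| * ‖μ‖ + ‖f‖ * ‖φ‖ * ‖μ‖
        + (‖φ‖ + |r|) * ‖μ‖ := by positivity
    calc |d φ μ + γ * m φ μ + r * f μ| ≤ |d φ μ| + |γ * m φ μ| + |r * f μ| := abs_add_three _ _ _
      _ ≤ ‖d‖ * ‖φ‖ * ‖μ‖ + γ * (‖m‖ * ‖φ‖ * ‖μ‖) + |r| * (‖f‖ * ‖μ‖) := by gcongr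
      _ ≤ K * (‖φ‖ + |r|) * ‖μ‖ := by rw [hK]; linarith
  have e2 : κ * (d φ μ + γ * m φ μ + r * f μ)
      ≤ κ / 2 * ‖μ‖ ^ 2 + g / 2 * (‖φ‖ ^ 2 + r ^ 2) := by
    have hs : (‖φ‖ + |r|) ^ 2 ≤ 2 * (‖φ‖ ^ 2 + r ^ 2) := by
      have := sq_nonneg (‖φ‖ - |r|)
      have h2 := sq_abs r
      nlinarith
    have hy : K * (‖φ‖ + |r|) * ‖μ‖ ≤ ‖μ‖ ^ 2 / 2 + K ^ 2 * (‖φ‖ + |r|) ^ 2 / 2 := by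
      nlinarith [sq_nonneg (‖μ‖ - K * (‖φ‖ + |r|))]
    calc κ * (d φ μ + γ * m φ μ + r * f μ) ≤ κ * (K * (‖φ‖ + |r|) * ‖μ‖) := by
          gcongr; exact (le_abs_self _).trans e1
      _ ≤ κ * (‖μ‖ ^ 2 / 2 + K ^ 2 * (2 * (‖φ‖ ^ 2 + r ^ 2)) / 2) := by
          gcongr; refine hy.trans ?_; gcongr
      _ = κ / 2 * ‖μ‖ ^ 2 + κ * K ^ 2 * (‖φ‖ ^ 2 + r ^ 2) := by ring
      _ ≤ _ := by gcongr
  have e3 : κ * ‖μ‖ ^ 2 ≤ β * d μ μ + κ * m μ μ := by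
    rw [← hmd]
    have := mul_le_mul_of_nonneg_right hκβ (hd0 μ)
    linarith
  have e4 : g * ‖φ‖ ^ 2 ≤ d φ φ + γ * m φ φ := by
    rw [← hmd]
    have h1 := mul_le_mul_of_nonneg_right hg1 (hd0 φ)
    have h2 := mul_le_mul_of_nonneg_right hgγ (hm0 φ)
    linarith
  set c₀ := min (g / 2) (κ / 2)
  have c1 : c₀ * ‖φ‖ ^ 2 ≤ g / 2 * ‖φ‖ ^ 2 := by
    gcongr; exact min_le_left _ _
  have c2 : c₀ * ‖μ‖ ^ 2 ≤ κ / 2 * ‖μ‖ ^ 2 := by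
    gcongr; exact min_le_right _ _
  have c4 : c₀ * r ^ 2 ≤ 1 * r ^ 2 := by
    gcongr
    exact (min_le_left _ _).trans (by linarith)
  have c6 : g / 2 * r ^ 2 ≤ 1 * r ^ 2 := by gcongr; linarith
  linarith

/-- The coupled system is uniquely solvable. When every equation is tested with its own unknown,
all couplings cancel and only the mass part of `μ` is not controlled; testing the equation for `μ`
with `φ - κ μ`, for small `κ`, makes the form coercive, and the Lax-Milgram theorem applies. -/
theorem exists_unique_isCoupledSolution_of_coordinates {X : Type*} [NormedAddCommGroup X]
    [InnerProductSpace ℝ X] [CompleteSpace X] (π₁ π₂ : X →L[ℝ] H) (π₃ : X →L[ℝ] V)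
    (π₄ π₅ : X →L[ℝ] ℝ) (mk : H → H → V → ℝ → ℝ → X)
    (hmk : ∀ φ μ w r q, π₁ (mk φ μ w r q) = φ ∧ π₂ (mk φ μ w r q) = μ ∧ π₃ (mk φ μ w r q) = w ∧
      π₄ (mk φ μ w r q) = r ∧ π₅ (mk φ μ w r q) = q)
    (hnorm : ∀ x : X, ‖x‖ ^ 2 = ‖π₁ x‖ ^ 2 + ‖π₂ x‖ ^ 2 + ‖π₃ x‖ ^ 2 + π₄ x ^ 2 + π₅ x ^ 2)
    (m d : H →L[ℝ] H →L[ℝ] ℝ) (b : V →L[ℝ] V →L[ℝ] ℝ)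
    (f a l : H →L[ℝ] ℝ) (k c l' : V →L[ℝ] ℝ) {β γ θ : ℝ} (r₀ q₀ : ℝ)
    (hβ : 0 < β) (hγ : 0 < γ) (hθ : 0 < θ) (hm : ∀ x y, m x y = m y x)
    (hm0 : ∀ x, 0 ≤ m x x) (hd0 : ∀ x, 0 ≤ d x x) (hmd : ∀ x, m x x + d x x = ‖x‖ ^ 2)
    (hb : IsCoercive b) :
    ∃ φ μ w r q, IsCoupledSolution m d b f a l k c l' β γ θ r₀ q₀ φ μ w r q ∧
      ∀ φ₂ μ₂ w₂ r₂ q₂, IsCoupledSolution m d b f a l k c l' β γ θ r₀ q₀ φ₂ μ₂ w₂ r₂ q₂ →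
        φ₂ = φ ∧ μ₂ = μ ∧ w₂ = w ∧ r₂ = r ∧ q₂ = q := by
  obtain ⟨cb, hcb, hbc⟩ := hb
  obtain ⟨κ, hκ, C₀, hC₀, hlow⟩ := exists_coupled_lower_bound m d f hβ hγ hm0 hd0 hmd
  let τ : X →L[ℝ] H := π₁ - κ • π₂
  let B : X →L[ℝ] X →L[ℝ] ℝ :=
    (m.bilinearComp π₁ π₂ + π₄.smulRight (a.comp π₂) + β • d.bilinearComp π₂ π₂)
      + (d.bilinearComp π₁ τ + γ • m.bilinearComp π₁ τ + π₄.smulRight (f.comp τ)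
          - m.bilinearComp π₂ τ)
      + (b.bilinearComp π₃ π₃ + π₅.smulRight (c.comp π₃) - π₄.smulRight (k.comp π₃))
      + ((2 : ℝ) • π₄ - (f.comp π₁ + a.comp π₂ - k.comp π₃)).smulRight π₄
      + (θ • π₅ - c.comp π₃).smulRight π₅
  have hB : ∀ x y, B x y =
      (m (π₁ x) (π₂ y) + π₄ x * a (π₂ y) + β * d (π₂ x) (π₂ y))
      + (d (π₁ x) (τ y) + γ * m (π₁ x) (τ y) + π₄ x * f (τ y) - m (π₂ x) (τ y))
      + (b (π₃ x) (π₃ y) + π₅ x * c (π₃ y) - π₄ x * k (π₃ y))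
      + (2 * π₄ x - (f (π₁ x) + a (π₂ x) - k (π₃ x))) * π₄ y
      + (θ * π₅ x - c (π₃ x)) * π₅ y := by
    intro x y
    simp [B]
  let L : X →L[ℝ] ℝ := l.comp π₂ + l'.comp π₃ + r₀ • π₄ + q₀ • π₅
  have hL : ∀ y, L y = l (π₂ y) + l' (π₃ y) + r₀ * π₄ y + q₀ * π₅ y := fun y => by simp [L]
  have hcoer : IsCoercive B := by
    refine ⟨min C₀ (min cb θ), by positivity, fun x => ?_⟩
    rw [mul_assoc, ← sq, hnorm, hB]
    set φ := π₁ x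
    set μ := π₂ x
    set w := π₃ x
    set r := π₄ x
    set q := π₅ x
    have hτ : τ x = φ - κ • μ := rfl
    have e5 := hbc w
    have e6 : (m φ μ + r * a μ + β * d μ μ)
        + (d φ (τ x) + γ * m φ (τ x) + r * f (τ x) - m μ (τ x))
        + (b w w + q * c w - r * k w)
        + (2 * r - (f φ + a μ - k w)) * r + (θ * q - c w) * q
        = β * d μ μ + κ * m μ μ + (d φ φ + γ * m φ φ) - κ * (d φ μ + γ * m φ μ + r * f μ)
          + b w w + 2 * r ^ 2 + θ * q ^ 2 := by
      rw [hτ]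
      simp only [map_sub, map_smul, smul_eq_mul]
      rw [hm μ φ]
      ring
    rw [e6]
    have e7 := hlow φ μ r
    set c₀ := min C₀ (min cb θ)
    have c2 : c₀ * (‖φ‖ ^ 2 + ‖μ‖ ^ 2 + r ^ 2) ≤ C₀ * (‖φ‖ ^ 2 + ‖μ‖ ^ 2 + r ^ 2) := by
      gcongr; exact min_le_left _ _
    have c3 : c₀ * ‖w‖ ^ 2 ≤ cb * ‖w‖ ^ 2 := by
      gcongr; exact (min_le_right _ _).trans (min_le_left _ _)
    have c5 : c₀ * q ^ 2 ≤ θ * q ^ 2 := by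
      gcongr; exact (min_le_right _ _).trans (min_le_right _ _)
    have c7 : cb * ‖w‖ ^ 2 ≤ b w w := by rw [sq, ← mul_assoc]; exact e5
    linarith
  -- solutions of the system are the solutions of the variational problem
  have hiff : ∀ φ μ w r q, IsCoupledSolution m d b f a l k c l' β γ θ r₀ q₀ φ μ w r q ↔
      ∀ y, B (mk φ μ w r q) y = L y := by
    intro φ μ w r q
    constructor
    · intro h y
      obtain ⟨h1, h2, h3, h4, h5⟩ := hmk φ μ w r q
      rw [hB, hL, h1, h2, h3, h4, h5, h.phi, h.mu, h.vel, h.aux_r, h.aux_q]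
      ring
    · intro h
      have h' : ∀ ψ χ v s t, (m φ χ + r * a χ + β * d μ χ)
          + (d φ (ψ - κ • χ) + γ * m φ (ψ - κ • χ) + r * f (ψ - κ • χ) - m μ (ψ - κ • χ))
          + (b w v + q * c v - r * k v)
          + (2 * r - (f φ + a μ - k w)) * s + (θ * q - c w) * t
          = l χ + l' v + r₀ * s + q₀ * t := by
        intro ψ χ v s t
        have := h (mk ψ χ v s t)
        have hτ : τ (mk ψ χ v s t) = π₁ (mk ψ χ v s t) - κ • π₂ (mk ψ χ v s t) := rfl
        obtain ⟨h1, h2, h3, h4, h5⟩ := hmk φ μ w r q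
        obtain ⟨h1', h2', h3', h4', h5'⟩ := hmk ψ χ v s t
        rwa [hB, hL, hτ, h1, h2, h3, h4, h5, h1', h2', h3', h4', h5'] at this
      have hmu : ∀ ψ, d φ ψ + γ * m φ ψ + r * f ψ = m μ ψ := by
        intro ψ
        have := h' ψ 0 0 0 0
        simp only [map_zero, smul_zero, sub_zero, mul_zero, add_zero, zero_add] at this
        linarith
      refine ⟨fun χ => ?_, hmu, fun v => ?_, ?_, ?_⟩
      · have := h' (κ • χ) χ 0 0 0
        simpa using this
      · simpa using h' 0 0 v 0 0
      · simpa using h' 0 0 0 1 0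
      · simpa using h' 0 0 0 0 1
  obtain ⟨x, hxs, hxu⟩ := exists_unique_of_isCoercive hcoer L
  have hmkx : mk (π₁ x) (π₂ x) (π₃ x) (π₄ x) (π₅ x) = x := by
    obtain ⟨h1, h2, h3, h4, h5⟩ := hmk (π₁ x) (π₂ x) (π₃ x) (π₄ x) (π₅ x)
    have h0 := hnorm (mk (π₁ x) (π₂ x) (π₃ x) (π₄ x) (π₅ x) - x)
    simp only [map_sub, h1, h2, h3, h4, h5, sub_self, norm_zero] at h0
    exact sub_eq_zero.1 (norm_eq_zero.1 (pow_eq_zero_iff two_ne_zero |>.1 (by simpa using h0)))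
  refine ⟨π₁ x, π₂ x, π₃ x, π₄ x, π₅ x, (hiff _ _ _ _ _).2 (by rwa [hmkx]),
    fun φ₂ μ₂ w₂ r₂ q₂ h₂ => ?_⟩
  have heq : mk φ₂ μ₂ w₂ r₂ q₂ = x := hxu _ ((hiff _ _ _ _ _).1 h₂)
  obtain ⟨h1, h2, h3, h4, h5⟩ := hmk φ₂ μ₂ w₂ r₂ q₂
  rw [heq] at h1 h2 h3 h4 h5
  exact ⟨h1.symm, h2.symm, h3.symm, h4.symm, h5.symm⟩

theorem exists_unique_isCoupledSolution [CompleteSpace H] [CompleteSpace V]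
    (m d : H →L[ℝ] H →L[ℝ] ℝ) (b : V →L[ℝ] V →L[ℝ] ℝ)
    (f a l : H →L[ℝ] ℝ) (k c l' : V →L[ℝ] ℝ) {β γ θ : ℝ} (r₀ q₀ : ℝ)
    (hβ : 0 < β) (hγ : 0 < γ) (hθ : 0 < θ) (hm : ∀ x y, m x y = m y x)
    (hm0 : ∀ x, 0 ≤ m x x) (hd0 : ∀ x, 0 ≤ d x x) (hmd : ∀ x, m x x + d x x = ‖x‖ ^ 2)
    (hb : IsCoercive b) :
    ∃ φ μ w r q, IsCoupledSolution m d b f a l k c l' β γ θ r₀ q₀ φ μ w r q ∧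
      ∀ φ₂ μ₂ w₂ r₂ q₂, IsCoupledSolution m d b f a l k c l' β γ θ r₀ q₀ φ₂ μ₂ w₂ r₂ q₂ →
        φ₂ = φ ∧ μ₂ = μ ∧ w₂ = w ∧ r₂ = r ∧ q₂ = q := by
  let X := WithLp 2 (H × WithLp 2 (H × WithLp 2 (V × WithLp 2 (ℝ × ℝ))))
  let π₁ : X →L[ℝ] H := WithLp.fstL 2 ℝ _ _
  let σ₁ : X →L[ℝ] WithLp 2 (H × WithLp 2 (V × WithLp 2 (ℝ × ℝ))) := WithLp.sndL 2 ℝ _ _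
  let π₂ : X →L[ℝ] H := (WithLp.fstL 2 ℝ _ _).comp σ₁
  let σ₂ : X →L[ℝ] WithLp 2 (V × WithLp 2 (ℝ × ℝ)) := (WithLp.sndL 2 ℝ _ _).comp σ₁
  let π₃ : X →L[ℝ] V := (WithLp.fstL 2 ℝ _ _).comp σ₂
  let σ₃ : X →L[ℝ] WithLp 2 (ℝ × ℝ) := (WithLp.sndL 2 ℝ _ _).comp σ₂
  let π₄ : X →L[ℝ] ℝ := (WithLp.fstL 2 ℝ _ _).comp σ₃
  let π₅ : X →L[ℝ] ℝ := (WithLp.sndL 2 ℝ _ _).comp σ₃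
  let mk : H → H → V → ℝ → ℝ → X := fun φ μ w r q =>
    WithLp.toLp 2 (φ, WithLp.toLp 2 (μ, WithLp.toLp 2 (w, WithLp.toLp 2 (r, q))))
  have hnorm : ∀ x : X, ‖x‖ ^ 2 = ‖π₁ x‖ ^ 2 + ‖π₂ x‖ ^ 2 + ‖π₃ x‖ ^ 2 + π₄ x ^ 2 + π₅ x ^ 2 := by
    intro x
    have h1 := WithLp.prod_norm_sq_eq_of_L2 x
    have h2 := WithLp.prod_norm_sq_eq_of_L2 x.snd
    have h3 := WithLp.prod_norm_sq_eq_of_L2 x.snd.snd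
    have h4 := WithLp.prod_norm_sq_eq_of_L2 x.snd.snd.snd
    have h5 : ‖x.snd.snd.snd.fst‖ ^ 2 = π₄ x ^ 2 := by rw [Real.norm_eq_abs, sq_abs]; rfl
    have h6 : ‖x.snd.snd.snd.snd‖ ^ 2 = π₅ x ^ 2 := by rw [Real.norm_eq_abs, sq_abs]; rfl
    rw [h1, h2, h3, h4, h5, h6]
    simp only [← add_assoc]
    rfl
  exact exists_unique_isCoupledSolution_of_coordinates π₁ π₂ π₃ π₄ π₅ mk
    (fun _ _ _ _ _ => ⟨rfl, rfl, rfl, rfl, rfl⟩) hnorm m d b f a l k c l' r₀ q₀ hβ hγ hθ hm hm0 hd0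
    hmd hb

end Coupled

/-! ### Sobolev spaces as Hilbert spaces -/

section Sobolev

open Filter Topology
open scoped ENNReal

/-- Pairs of a square integrable function and a square integrable vector field on `Ω`. -/
abbrev L2Pair (Ω : Set E2) : Type :=
  WithLp 2 (Lp ℝ 2 (volume.restrict Ω) × Lp E2 2 (volume.restrict Ω))

variable {Ω : Set E2} {f : E2 → ℝ} {ψ : E2 → ℝ}

lemma locallyIntegrableOn_of_memLp {V : Type*} [NormedAddCommGroup V] {h : E2 → V}
    (hΩ : IsOpen Ω) (hh : MemLp h 2 (volume.restrict Ω)) : LocallyIntegrableOn h Ω := by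
  have := hh.locallyIntegrable one_le_two
  rw [← locallyIntegrableOn_univ] at this
  intro x hx
  obtain ⟨s, hs, hi⟩ := this x trivial
  rw [nhdsWithin_univ] at hs
  refine ⟨s ∩ Ω, inter_mem (mem_nhdsWithin_of_mem_nhds hs) self_mem_nhdsWithin, ?_⟩
  rwa [IntegrableOn, Measure.restrict_restrict' hΩ.measurableSet] at hi

lemma IsTest.memLp (h : IsTest Ω ψ) : MemLp ψ 2 (volume.restrict Ω) :=
  (h.continuous.memLp_of_hasCompactSupport h.compact).restrict _

lemma IsTest.memLp_gradient (h : IsTest Ω ψ) : MemLp (gradient ψ) 2 (volume.restrict Ω) := by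
  refine ((gradient_continuous h.smooth).memLp_of_hasCompactSupport ?_).restrict _
  exact (h.compact.fderiv (𝕜 := ℝ)).comp_left (map_zero _)

lemma IsTest.memLp_fderiv_apply (h : IsTest Ω ψ) (v : E2) :
    MemLp (fun x => fderiv ℝ ψ x v) 2 (volume.restrict Ω) :=
  ((h.continuous_fderiv_apply v).memLp_of_hasCompactSupport (h.compact_fderiv_apply v)).restrict _

lemma IsTest.memLp_smul (h : IsTest Ω ψ) (v : E2) :
    MemLp (fun x => ψ x • v) 2 (volume.restrict Ω) :=
  ((h.continuous.smul continuous_const).memLp_of_hasCompactSupport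
    (h.compact.smul_right)).restrict _

/-- Being a weak gradient is a family of closed linear conditions on pairs in `L² × L²`. -/
lemma isWeakGrad_coe_iff (hΩ : IsOpen Ω) (x : L2Pair Ω) :
    IsWeakGrad Ω x.fst x.snd ↔ ∀ (ψ : E2 → ℝ) (h : IsTest Ω ψ) (v : E2),
      inner ℝ ((h.memLp_fderiv_apply v).toLp _) x.fst
        + inner ℝ ((h.memLp_smul v).toLp _) x.snd = 0 := by
  have key : ∀ (ψ : E2 → ℝ) (h : IsTest Ω ψ) (v : E2),
      inner ℝ ((h.memLp_fderiv_apply v).toLp _) x.fst = ∫ y in Ω, x.fst y * fderiv ℝ ψ y v ∧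
      inner ℝ ((h.memLp_smul v).toLp _) x.snd = ∫ y in Ω, ψ y * inner ℝ (x.snd y) v := by
    intro ψ h v
    constructor
    · rw [L2.inner_def]
      refine integral_congr_ae ?_
      filter_upwards [(h.memLp_fderiv_apply v).coeFn_toLp] with y hy
      rw [hy]
      rfl
    · rw [L2.inner_def]
      refine integral_congr_ae ?_
      filter_upwards [(h.memLp_smul v).coeFn_toLp] with y hy
      rw [hy, real_inner_smul_left, real_inner_comm]
  constructor
  · intro hx ψ h v
    rw [(key ψ h v).1, (key ψ h v).2, hx.identity h v, neg_add_cancel]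
  · intro hx
    refine ⟨locallyIntegrableOn_of_memLp hΩ (Lp.memLp _),
      locallyIntegrableOn_of_memLp hΩ (Lp.memLp _), fun ψ a b c v => ?_⟩
    have := hx ψ ⟨a, b, c⟩ v
    rw [(key ψ ⟨a, b, c⟩ v).1, (key ψ ⟨a, b, c⟩ v).2] at this
    linarith

/-- `H¹(Ω)` as the space of pairs of a function and its weak gradient, with the `H¹` inner
product inherited from the product of the `L²` spaces. -/
def sobolev (Ω : Set E2) : Submodule ℝ (L2Pair Ω) where
  carrier := {x | IsWeakGrad Ω x.fst x.snd}
  zero_mem' := by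
    refine (isWeakGrad_const 0).congr ?_ ?_
    · exact (Lp.coeFn_zero ℝ 2 (volume.restrict Ω)).symm
    · exact (Lp.coeFn_zero E2 2 (volume.restrict Ω)).symm
  add_mem' := fun {x y} hx hy => (IsWeakGrad.add hx hy).congr
    (Lp.coeFn_add x.fst y.fst).symm (Lp.coeFn_add x.snd y.snd).symm
  smul_mem' := fun c x hx => (IsWeakGrad.const_smul hx c).congr
    (Lp.coeFn_smul c x.fst).symm (Lp.coeFn_smul c x.snd).symm

lemma isClosed_sobolev (hΩ : IsOpen Ω) : IsClosed (sobolev Ω : Set (L2Pair Ω)) := by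
  have : (sobolev Ω : Set (L2Pair Ω)) = ⋂ (ψ : E2 → ℝ) (h : IsTest Ω ψ) (v : E2),
      {x | inner ℝ ((h.memLp_fderiv_apply v).toLp _) x.fst
        + inner ℝ ((h.memLp_smul v).toLp _) x.snd = 0} := by
    ext x
    simp only [Set.mem_iInter]
    exact isWeakGrad_coe_iff hΩ x
  rw [this]
  refine isClosed_iInter fun ψ => isClosed_iInter fun h => isClosed_iInter fun v => ?_
  refine isClosed_eq ?_ continuous_const
  have h1 : Continuous (fun x : L2Pair Ω => x.fst) := (WithLp.fstL 2 ℝ _ _).continuous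
  have h2 : Continuous (fun x : L2Pair Ω => x.snd) := (WithLp.sndL 2 ℝ _ _).continuous
  exact (continuous_const.inner h1).add (continuous_const.inner h2)

lemma snd_ae_eq_weakGrad (hΩ : IsOpen Ω) {x : L2Pair Ω} (hx : x ∈ sobolev Ω)
    (h : x.fst =ᵐ[volume.restrict Ω] f) : x.snd =ᵐ[volume.restrict Ω] weakGrad Ω f :=
  ((IsWeakGrad.congr hx h ae_eq_rfl).weakGrad_ae_eq hΩ).symm

lemma memH1_iff : MemH1 Ω f ↔ ∃ x ∈ sobolev Ω, x.fst =ᵐ[volume.restrict Ω] f := by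
  constructor
  · rintro ⟨hf, g, hg, hgm⟩
    refine ⟨WithLp.toLp 2 (hf.toLp f, hgm.toLp g), ?_, hf.coeFn_toLp⟩
    exact hg.congr hf.coeFn_toLp.symm hgm.coeFn_toLp.symm
  · rintro ⟨x, hx, hxf⟩
    exact ⟨(Lp.memLp x.fst).ae_eq hxf, x.snd, IsWeakGrad.congr hx hxf ae_eq_rfl, Lp.memLp x.snd⟩

lemma MemH1.isWeakGrad (h : MemH1 Ω f) : IsWeakGrad Ω f (weakGrad Ω f) :=
  isWeakGrad_weakGrad ⟨_, h.2.choose_spec.1⟩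

lemma MemH1.memLp_weakGrad (hΩ : IsOpen Ω) (h : MemH1 Ω f) :
    MemLp (weakGrad Ω f) 2 (volume.restrict Ω) := by
  obtain ⟨-, g, hg, hgm⟩ := h
  exact hgm.ae_eq (hg.weakGrad_ae_eq hΩ).symm

/-- `C_c^∞(Ω)`, embedded in the space of pairs by `ψ ↦ (ψ, ∇ψ)`. -/
def testPairs (Ω : Set E2) : Submodule ℝ (L2Pair Ω) where
  carrier := {x | ∃ ψ, IsTest Ω ψ ∧ x.fst =ᵐ[volume.restrict Ω] ψ ∧
    x.snd =ᵐ[volume.restrict Ω] gradient ψ}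
  zero_mem' := by
    refine ⟨fun _ => 0, ⟨contDiff_const, HasCompactSupport.zero, by simp⟩, ?_, ?_⟩
    · exact Lp.coeFn_zero ℝ 2 (volume.restrict Ω)
    · refine (Lp.coeFn_zero E2 2 (volume.restrict Ω)).trans (Eventually.of_forall fun x => ?_)
      simp [gradient]
  add_mem' := by
    rintro x y ⟨ψ, hψ, h1, h2⟩ ⟨χ, hχ, h3, h4⟩
    refine ⟨ψ + χ, ⟨hψ.smooth.add hχ.smooth, hψ.compact.add hχ.compact,
      (tsupport_add ψ χ).trans (Set.union_subset hψ.support hχ.support)⟩, ?_, ?_⟩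
    · exact (Lp.coeFn_add x.fst y.fst).trans (h1.add h3)
    · refine (Lp.coeFn_add x.snd y.snd).trans ((h2.add h4).trans
        (Eventually.of_forall fun z => ?_))
      simp only [gradient, Pi.add_apply]
      rw [fderiv_add (hψ.smooth.differentiable (by simp)).differentiableAt
        (hχ.smooth.differentiable (by simp)).differentiableAt, map_add]
  smul_mem' := by
    rintro c x ⟨ψ, hψ, h1, h2⟩
    refine ⟨c • ψ, ⟨hψ.smooth.const_smul c, hψ.compact.smul_left, ?_⟩, ?_, ?_⟩
    · refine (closure_mono fun z hz => ?_).trans hψ.support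
      intro h0
      exact hz (by simp [h0])
    · exact (Lp.coeFn_smul c x.fst).trans (h1.const_smul c)
    · refine (Lp.coeFn_smul c x.snd).trans ((h2.const_smul c).trans
        (Eventually.of_forall fun z => ?_))
      simp only [gradient, Pi.smul_apply]
      rw [fderiv_const_smul (hψ.smooth.differentiable (by simp)).differentiableAt, map_smul]

/-- `H¹₀(Ω)` as the closure of `C_c^∞(Ω)` in the space of pairs. -/
noncomputable def sobolevZero (Ω : Set E2) : Submodule ℝ (L2Pair Ω) := (testPairs Ω).topologicalClosure

lemma sobolevZero_le (hΩ : IsOpen Ω) : sobolevZero Ω ≤ sobolev Ω := by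
  refine Submodule.topologicalClosure_minimal _ ?_ (isClosed_sobolev hΩ)
  rintro x ⟨ψ, hψ, h1, h2⟩
  exact (isWeakGrad_gradient hψ.smooth).congr h1.symm h2.symm

lemma norm_sq_L2Pair_sub {x y : L2Pair Ω} {f₁ f₂ : E2 → ℝ} {g₁ g₂ : E2 → E2}
    (h1 : x.fst =ᵐ[volume.restrict Ω] f₁) (h2 : x.snd =ᵐ[volume.restrict Ω] g₁)
    (h3 : y.fst =ᵐ[volume.restrict Ω] f₂) (h4 : y.snd =ᵐ[volume.restrict Ω] g₂) :
    ‖x - y‖ ^ 2 = (∫ z in Ω, (f₁ z - f₂ z) ^ 2) + ∫ z in Ω, ‖g₁ z - g₂ z‖ ^ 2 := by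
  rw [WithLp.prod_norm_sq_eq_of_L2]
  congr 1
  · rw [← real_inner_self_eq_norm_sq, L2.inner_def]
    refine integral_congr_ae ?_
    filter_upwards [Lp.coeFn_sub x.fst y.fst, h1, h3] with z hz e1 e3
    have : (x - y).fst = x.fst - y.fst := rfl
    rw [this, hz, Pi.sub_apply, e1, e3, real_inner_self_eq_norm_sq, Real.norm_eq_abs, sq_abs]
  · rw [← real_inner_self_eq_norm_sq, L2.inner_def]
    refine integral_congr_ae ?_
    filter_upwards [Lp.coeFn_sub x.snd y.snd, h2, h4] with z hz e1 e3
    have : (x - y).snd = x.snd - y.snd := rfl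
    rw [this, hz, Pi.sub_apply, e1, e3, real_inner_self_eq_norm_sq]

/-- The approximation by test functions in the definition of `H¹₀(Ω)` is a closure in `L² × L²`. -/
lemma memH10_iff (hΩ : IsOpen Ω) :
    MemH10 Ω f ↔ ∃ x ∈ sobolevZero Ω, x.fst =ᵐ[volume.restrict Ω] f := by
  constructor
  · rintro ⟨hf, happ⟩
    obtain ⟨x, hx, hxf⟩ := memH1_iff.1 hf
    refine ⟨x, ?_, hxf⟩
    have hxg := snd_ae_eq_weakGrad hΩ hx hxf
    rw [sobolevZero, ← SetLike.mem_coe, Submodule.topologicalClosure_coe, Metric.mem_closure_iff]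
    intro ε hε
    obtain ⟨ψ, a, b, c, hψ⟩ := happ (ε ^ 2) (by positivity)
    have ht : IsTest Ω ψ := ⟨a, b, c⟩
    let y : L2Pair Ω := WithLp.toLp 2 (ht.memLp.toLp ψ, ht.memLp_gradient.toLp _)
    have hy₁ : y.fst =ᵐ[volume.restrict Ω] ψ := ht.memLp.coeFn_toLp
    have hy₂ : y.snd =ᵐ[volume.restrict Ω] gradient ψ := ht.memLp_gradient.coeFn_toLp
    refine ⟨y, ⟨ψ, ht, hy₁, hy₂⟩, ?_⟩
    rw [dist_eq_norm]
    refine lt_of_pow_lt_pow_left₀ 2 hε.le ?_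
    rwa [norm_sq_L2Pair_sub hxf hxg hy₁ hy₂]
  · rintro ⟨x, hx, hxf⟩
    have hxs := sobolevZero_le hΩ hx
    have hxg := snd_ae_eq_weakGrad hΩ hxs hxf
    refine ⟨memH1_iff.2 ⟨x, hxs, hxf⟩, fun ε hε => ?_⟩
    rw [sobolevZero, ← SetLike.mem_coe, Submodule.topologicalClosure_coe,
      Metric.mem_closure_iff] at hx
    obtain ⟨y, ⟨ψ, ht, hy1, hy2⟩, hy⟩ := hx (√ε) (Real.sqrt_pos.2 hε)
    refine ⟨ψ, ht.smooth, ht.compact, ht.support, ?_⟩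
    rw [← norm_sq_L2Pair_sub hxf hxg hy1 hy2, ← dist_eq_norm]
    exact (Real.lt_sqrt dist_nonneg).1 hy

/-- A pairing which converges absolutely for every element of a Banach space that maps
continuously to `L²` is a bounded functional, by the closed graph theorem. -/
lemma exists_continuous_pairing {X E α : Type*} [NormedAddCommGroup X] [NormedSpace ℝ X]
    [CompleteSpace X] [NormedAddCommGroup E] [InnerProductSpace ℝ E] [MeasurableSpace α]
    {ν : Measure α} (J : X →L[ℝ] Lp E 2 ν) (k : α → E)
    (hk : ∀ x, Integrable (fun a => inner ℝ (k a) (J x a)) ν) :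
    ∃ l : X →L[ℝ] ℝ, ∀ x, l x = ∫ a, inner ℝ (k a) (J x a) ∂ν := by
  let T : X →ₗ[ℝ] Lp ℝ 1 ν :=
    { toFun := fun x => (memLp_one_iff_integrable.2 (hk x)).toLp _
      map_add' := fun x y => by
        apply Lp.ext
        refine (MemLp.coeFn_toLp _).trans (EventuallyEq.trans ?_ (Lp.coeFn_add _ _).symm)
        filter_upwards [Lp.coeFn_add (J x) (J y),
          (memLp_one_iff_integrable.2 (hk x)).coeFn_toLp,
          (memLp_one_iff_integrable.2 (hk y)).coeFn_toLp] with a h1 h2 h3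
        rw [map_add, h1, Pi.add_apply, Pi.add_apply, h2, h3, inner_add_right]
      map_smul' := fun c x => by
        apply Lp.ext
        refine (MemLp.coeFn_toLp _).trans (EventuallyEq.trans ?_ (Lp.coeFn_smul _ _).symm)
        filter_upwards [Lp.coeFn_smul c (J x),
          (memLp_one_iff_integrable.2 (hk x)).coeFn_toLp] with a h1 h2
        rw [map_smul, h1, Pi.smul_apply, RingHom.id_apply, Pi.smul_apply, h2, inner_smul_right,
          smul_eq_mul] }
  have hT : ∀ x, T x =ᵐ[ν] fun a => inner ℝ (k a) (J x a) := fun x =>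
    (memLp_one_iff_integrable.2 (hk x)).coeFn_toLp
  have hcont : Continuous T := by
    refine T.continuous_of_seq_closed_graph fun u x y hu hTu => ?_
    -- along a subsequence both sides converge almost everywhere
    have m1 : TendstoInMeasure ν (fun n => J (u n)) atTop (J x) :=
      tendstoInMeasure_of_tendsto_Lp ((J.continuous.tendsto x).comp hu)
    obtain ⟨s, hs, hs'⟩ := m1.exists_seq_tendsto_ae
    have m2 : TendstoInMeasure ν (fun n => (T ∘ u) (s n)) atTop y :=
      tendstoInMeasure_of_tendsto_Lp (hTu.comp hs.tendsto_atTop)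
    obtain ⟨t, ht, ht'⟩ := m2.exists_seq_tendsto_ae
    apply Lp.ext
    have hall : ∀ᵐ a ∂ν, ∀ n, T (u n) a = inner ℝ (k a) (J (u n) a) :=
      ae_all_iff.2 fun n => hT (u n)
    filter_upwards [hs', ht', hT x, hall] with a h1 h2 h3 h4
    rw [h3]
    refine tendsto_nhds_unique h2 ?_
    simp only [Function.comp_apply, h4]
    exact tendsto_const_nhds.inner (h1.comp ht.tendsto_atTop)
  refine ⟨L1.integralCLM.comp ⟨T, hcont⟩, fun x => ?_⟩
  have : (L1.integralCLM.comp (⟨T, hcont⟩ : X →L[ℝ] Lp ℝ 1 ν)) x = L1.integral (T x) := by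
    rw [L1.integral_eq]
    rfl
  rw [this, L1.integral_eq_integral]
  exact integral_congr_ae (hT x)

end Sobolev

/-! ### The Helmholtz decomposition -/

section Helmholtz

open Filter Topology
open scoped ENNReal

variable {Ω : Set E2} {p p₁ p₂ : E2 → ℝ}

lemma MemPressure.isWeakGrad (h : MemPressure Ω p) : IsWeakGrad Ω p (weakGrad Ω p) :=
  isWeakGrad_weakGrad ⟨_, h.choose_spec.1⟩

lemma MemPressure.memLp_weakGrad (hΩ : IsOpen Ω) (h : MemPressure Ω p) :
    MemLp (weakGrad Ω p) 2 (volume.restrict Ω) := by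
  obtain ⟨g, hg, hgm⟩ := h
  exact hgm.ae_eq (hg.weakGrad_ae_eq hΩ).symm

lemma MemPressure.add_const_mul (h₁ : MemPressure Ω p₁) (h₂ : MemPressure Ω p₂) (c : ℝ) :
    MemPressure Ω (fun x => p₁ x + c * p₂ x) := by
  obtain ⟨g₁, hg₁, hm₁⟩ := h₁
  obtain ⟨g₂, hg₂, hm₂⟩ := h₂
  exact ⟨_, hg₁.add (hg₂.const_smul c), hm₁.add (hm₂.const_smul c)⟩

lemma MemPressure.sub (h₁ : MemPressure Ω p₁) (h₂ : MemPressure Ω p₂) :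
    MemPressure Ω (fun x => p₁ x - p₂ x) := by
  obtain ⟨g₁, hg₁, hm₁⟩ := h₁
  obtain ⟨g₂, hg₂, hm₂⟩ := h₂
  exact ⟨_, hg₁.sub hg₂, hm₁.sub hm₂⟩

lemma weakGrad_sub (hΩ : IsOpen Ω) {f₁ f₂ : E2 → ℝ} {g₁ g₂ : E2 → E2}
    (h₁ : IsWeakGrad Ω f₁ g₁) (h₂ : IsWeakGrad Ω f₂ g₂) :
    weakGrad Ω (fun x => f₁ x - f₂ x)
      =ᵐ[volume.restrict Ω] fun x => weakGrad Ω f₁ x - weakGrad Ω f₂ x :=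
  ((isWeakGrad_weakGrad ⟨_, h₁⟩).sub (isWeakGrad_weakGrad ⟨_, h₂⟩)).weakGrad_ae_eq hΩ

/-- The square integrable gradients on `Ω`. -/
def gradients (Ω : Set E2) : Submodule ℝ (Lp E2 2 (volume.restrict Ω)) where
  carrier := {g | ∃ p, IsWeakGrad Ω p g}
  zero_mem' := ⟨fun _ => 0, (isWeakGrad_const 0).congr ae_eq_rfl
    (Lp.coeFn_zero E2 2 (volume.restrict Ω)).symm⟩
  add_mem' := by
    rintro g₁ g₂ ⟨p₁, h₁⟩ ⟨p₂, h₂⟩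
    exact ⟨_, (h₁.add h₂).congr ae_eq_rfl (Lp.coeFn_add g₁ g₂).symm⟩
  smul_mem' := by
    rintro c g ⟨p, h⟩
    exact ⟨_, (h.const_smul c).congr ae_eq_rfl (Lp.coeFn_smul c g).symm⟩

/-- On a bounded domain convergence in `L²` implies convergence in `L¹`, where limits of gradients
are gradients. -/
lemma isClosed_gradients (hΩ : IsOpen Ω) (hc : IsConnected Ω) (hb : Bornology.IsBounded Ω) :
    IsClosed (gradients Ω : Set (Lp E2 2 (volume.restrict Ω))) := by
  refine isClosed_of_closure_subset fun g hg => ?_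
  have hfin : volume Ω ≠ ∞ := hb.measure_lt_top.ne
  have hA : (volume.restrict Ω Set.univ) ^ (1 / (1 : ℝ≥0∞).toReal - 1 / (2 : ℝ≥0∞).toReal) ≠ ∞ := by
    refine ENNReal.rpow_ne_top_of_nonneg (by norm_num) ?_
    rwa [Measure.restrict_apply_univ]
  set A := (volume.restrict Ω Set.univ) ^ (1 / (1 : ℝ≥0∞).toReal - 1 / (2 : ℝ≥0∞).toReal) with hAdef
  have happ : ∀ n : ℕ, ∃ h ∈ gradients Ω, ‖h - g‖ < 2⁻¹ ^ n / (A.toReal + 1) := by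
    intro n
    obtain ⟨h, hh, hd⟩ := Metric.mem_closure_iff.1 hg (2⁻¹ ^ n / (A.toReal + 1)) (by positivity)
    exact ⟨h, hh, by rwa [dist_comm, dist_eq_norm] at hd⟩
  choose G hG hGn using happ
  choose F hF using hG
  refine exists_isWeakGrad_of_tendsto hΩ hc hF (locallyIntegrableOn_of_memLp hΩ (Lp.memLp g))
    fun n => ?_
  have hm : AEStronglyMeasurable (fun x => G n x - g x) (volume.restrict Ω) :=
    (Lp.aestronglyMeasurable _).sub (Lp.aestronglyMeasurable _)
  have h2 : eLpNorm (fun x => G n x - g x) 2 (volume.restrict Ω) = ‖G n - g‖ₑ := by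
    rw [Lp.enorm_def]
    exact eLpNorm_congr_ae (Lp.coeFn_sub (G n) g).symm
  calc ∫⁻ x in Ω, ‖G n x - g x‖ₑ = eLpNorm (fun x => G n x - g x) 1 (volume.restrict Ω) :=
        eLpNorm_one_eq_lintegral_enorm.symm
    _ ≤ eLpNorm (fun x => G n x - g x) 2 (volume.restrict Ω) * A :=
        eLpNorm_le_eLpNorm_mul_rpow_measure_univ one_le_two hm
    _ ≤ ENNReal.ofReal (2⁻¹ ^ n / (A.toReal + 1)) * ENNReal.ofReal A.toReal := by
        rw [h2, ENNReal.ofReal_toReal hA, ← ofReal_norm]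
        gcongr
        exact (hGn n).le
    _ ≤ ENNReal.ofReal (2⁻¹ ^ n) := by
        rw [← ENNReal.ofReal_mul (by positivity)]
        refine ENNReal.ofReal_le_ofReal ?_
        rw [div_mul_eq_mul_div, div_le_iff₀ (by positivity)]
        have : (0 : ℝ) < 2⁻¹ ^ n := by positivity
        nlinarith
    _ = 2⁻¹ ^ n := by
        rw [ENNReal.ofReal_pow (by norm_num), ENNReal.ofReal_inv_of_pos (by norm_num),
          ENNReal.ofReal_ofNat]

/-- The Helmholtz decomposition of a square integrable vector field. It is the orthogonal
projection onto the gradients, which form a closed subspace. -/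
lemma exists_helmholtz (hΩ : IsOpen Ω) (hc : IsConnected Ω) (hb : Bornology.IsBounded Ω)
    {v : E2 → E2} (hv : MemLp v 2 (volume.restrict Ω)) :
    ∃ (u : E2 → E2) (p : E2 → ℝ), MemH Ω u ∧ MemPressure Ω p ∧
      ∀ᵐ x ∂volume.restrict Ω, v x = u x + weakGrad Ω p x := by
  have := (isClosed_gradients hΩ hc hb).completeSpace_coe
  obtain ⟨g, ⟨p, hp⟩, u, hu, hgu⟩ := (gradients Ω).exists_add_mem_mem_orthogonal (hv.toLp v)
  refine ⟨u, p, ⟨Lp.memLp u, fun ψ hψ => ?_⟩, ⟨g, hp, Lp.memLp g⟩, ?_⟩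
  · have hψm := hψ.memLp_weakGrad hΩ
    have h0 := (Submodule.mem_orthogonal _ u).1 hu (hψm.toLp _)
      ⟨ψ, hψ.isWeakGrad.congr ae_eq_rfl hψm.coeFn_toLp.symm⟩
    rw [real_inner_comm, L2.inner_def] at h0
    rw [← h0]
    refine integral_congr_ae ?_
    filter_upwards [hψm.coeFn_toLp] with x hx
    rw [hx]
  · filter_upwards [hv.coeFn_toLp, Lp.coeFn_add g u, hp.weakGrad_ae_eq hΩ] with x h1 h2 h3
    rw [h3, ← h1, hgu, h2, Pi.add_apply, add_comm]

end Helmholtz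

/-! ### Energy stability -/

section Energy

variable {Ω : Set E2}

lemma integrable_inner_of_memLp {α E : Type*} [MeasurableSpace α] {ν : Measure α}
    [NormedAddCommGroup E] [InnerProductSpace ℝ E] {a b : α → E} (ha : MemLp a 2 ν)
    (hb : MemLp b 2 ν) : Integrable (fun x => inner ℝ (a x) (b x)) ν := by
  refine (L2.integrable_inner (𝕜 := ℝ) (ha.toLp a) (hb.toLp b)).congr ?_
  filter_upwards [ha.coeFn_toLp, hb.coeFn_toLp] with x h1 h2
  rw [h1, h2]

lemma integrable_norm_sq_of_memLp {α E : Type*} [MeasurableSpace α] {ν : Measure α}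
    [NormedAddCommGroup E] [InnerProductSpace ℝ E] {a : α → E} (ha : MemLp a 2 ν) :
    Integrable (fun x => ‖a x‖ ^ 2) ν := by
  simpa only [real_inner_self_eq_norm_sq] using integrable_inner_of_memLp ha ha

/-- The implicit Euler inequality `|a|² - |b|² ≤ 2 a · (a - b)`, integrated. -/
lemma integral_norm_sq_sub_le {α E : Type*} [MeasurableSpace α] {ν : Measure α}
    [NormedAddCommGroup E] [InnerProductSpace ℝ E] {a b : α → E} (ha : MemLp a 2 ν)
    (hb : MemLp b 2 ν) :
    (∫ x, ‖a x‖ ^ 2 ∂ν) - (∫ x, ‖b x‖ ^ 2 ∂ν) ≤ 2 * ∫ x, inner ℝ (a x) (a x - b x) ∂ν := by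
  rw [← integral_sub (integrable_norm_sq_of_memLp ha) (integrable_norm_sq_of_memLp hb),
    ← integral_const_mul]
  refine integral_mono
    ((integrable_norm_sq_of_memLp ha).sub (integrable_norm_sq_of_memLp hb))
    ((integrable_inner_of_memLp ha (ha.sub hb)).const_mul 2) fun x => ?_
  have h := norm_sub_sq_real (a x) (b x)
  have h0 := sq_nonneg ‖a x - b x‖
  simp only [inner_sub_right, real_inner_self_eq_norm_sq]
  linarith

lemma integral_norm_add_sq {α E : Type*} [MeasurableSpace α] {ν : Measure α}
    [NormedAddCommGroup E] [InnerProductSpace ℝ E] {a b : α → E} (ha : MemLp a 2 ν)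
    (hb : MemLp b 2 ν) (c : ℝ) :
    ∫ x, ‖a x + c • b x‖ ^ 2 ∂ν = (∫ x, ‖a x‖ ^ 2 ∂ν) + 2 * c * (∫ x, inner ℝ (a x) (b x) ∂ν)
      + c ^ 2 * ∫ x, ‖b x‖ ^ 2 ∂ν := by
  have h : ∀ x, ‖a x + c • b x‖ ^ 2
      = ‖a x‖ ^ 2 + 2 * c * inner ℝ (a x) (b x) + c ^ 2 * ‖b x‖ ^ 2 := by
    intro x
    rw [norm_add_sq_real, inner_smul_right, norm_smul, mul_pow, Real.norm_eq_abs, sq_abs]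
    ring
  simp only [h]
  rw [integral_add, integral_add, integral_const_mul, integral_const_mul]
  · exact integrable_norm_sq_of_memLp ha
  · exact (integrable_inner_of_memLp ha hb).const_mul _
  · exact (integrable_norm_sq_of_memLp ha).add ((integrable_inner_of_memLp ha hb).const_mul _)
  · exact (integrable_norm_sq_of_memLp hb).const_mul _

lemma memLp_two_of_components {v : E2 → E2}
    (h : ∀ i, MemLp (fun x => v x i) 2 (volume.restrict Ω)) : MemLp v 2 (volume.restrict Ω) :=
  MemLp.of_eval_piLp h

lemma MemH1Vec.memLp {v : E2 → E2} (h : MemH1Vec Ω v) : MemLp v 2 (volume.restrict Ω) :=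
  memLp_two_of_components fun i => (h i).1

lemma MemH10Vec.memLp {v : E2 → E2} (h : MemH10Vec Ω v) : MemLp v 2 (volume.restrict Ω) :=
  memLp_two_of_components fun i => (h i).1.1

lemma MemH1.sub {f₁ f₂ : E2 → ℝ} (h₁ : MemH1 Ω f₁) (h₂ : MemH1 Ω f₂) :
    MemH1 Ω (fun x => f₁ x - f₂ x) := by
  obtain ⟨hf₁, g₁, hg₁, hm₁⟩ := h₁
  obtain ⟨hf₂, g₂, hg₂, hm₂⟩ := h₂
  exact ⟨hf₁.sub hf₂, _, hg₁.sub hg₂, hm₁.sub hm₂⟩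

/-- The identity `u' + τ ∇p' = ũ + τ ∇p`, squared. The new velocity is orthogonal to gradients, so
there is no mixed term on the left. -/
lemma IsStep.pressure_identity (hΩ : IsOpen Ω) {P : Params} {τ t : ℝ} {s s' : State} {ut : E2 → E2}
    (hτ : 0 < τ) (hp : MemPressure Ω s.p) (h : IsStep Ω P τ t s ut s') :
    (∫ x in Ω, ‖s'.u x‖ ^ 2) + τ ^ 2 * (∫ x in Ω, ‖weakGrad Ω s'.p x‖ ^ 2)
      = (∫ x in Ω, ‖ut x‖ ^ 2) + 2 * τ * (∫ x in Ω, inner ℝ (weakGrad Ω s.p x) (ut x))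
        + τ ^ 2 * (∫ x in Ω, ‖weakGrad Ω s.p x‖ ^ 2) := by
  have h1 := integral_norm_add_sq h.u_solenoidal.1 (h.p_mem.memLp_weakGrad hΩ) τ
  have h2 := integral_norm_add_sq h.ut_mem.memLp (hp.memLp_weakGrad hΩ) τ
  rw [h.u_solenoidal.2 _ h.p_mem] at h1
  have h3 : ∫ x in Ω, ‖s'.u x + τ • weakGrad Ω s'.p x‖ ^ 2
      = ∫ x in Ω, ‖ut x + τ • weakGrad Ω s.p x‖ ^ 2 := by
    refine integral_congr_ae ?_
    filter_upwards [h.p_eq, weakGrad_sub hΩ h.p_mem.isWeakGrad hp.isWeakGrad] with x e1 e2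
    have : s'.u x + τ • weakGrad Ω s'.p x = ut x + τ • weakGrad Ω s.p x := by
      rw [e2] at e1
      have e3 : τ • (τ⁻¹ • (s'.u x - ut x) + (weakGrad Ω s'.p x - weakGrad Ω s.p x)) = 0 := by
        rw [e1, smul_zero]
      rw [smul_add, smul_smul, mul_inv_cancel₀ hτ.ne', one_smul, smul_sub] at e3
      rw [← sub_eq_zero, ← e3]
      abel
    rw [this]
  have h4 : ∫ x in Ω, inner ℝ (ut x) (weakGrad Ω s.p x)
      = ∫ x in Ω, inner ℝ (weakGrad Ω s.p x) (ut x) := by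
    simp only [real_inner_comm]
  rw [h3, h2, h4] at h1
  linarith

/-- One step of the scheme dissipates the modified energy. The equations are tested with
`μ`, with the increment of `φ`, with the intermediate velocity, and with the scalar unknowns; the
explicit couplings then cancel. -/
lemma IsStep.energy_le (hΩ : IsOpen Ω) {P : Params} {τ t : ℝ} {s s' : State} {ut : E2 → E2}
    (hτ : 0 < τ) (hγ : 0 < P.γ) (hs : Admissible Ω P s) (h : IsStep Ω P τ t s ut s') :
    energy Ω P τ s' - energy Ω P τ s
      ≤ -2 * P.M * τ * (∫ x in Ω, ‖weakGrad Ω s'.μ x‖ ^ 2)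
        - 2 * P.ν * τ * (∑ i, ∫ x in Ω, ‖weakGrad Ω (fun y => ut y i) x‖ ^ 2)
        - 2 * τ / P.T * s'.q ^ 2 := by
  have hp := h.pressure_identity hΩ hτ hs.p_mem
  have hφ := integral_norm_sq_sub_le (h.phi_mem.memLp_weakGrad hΩ) (hs.phi_mem.memLp_weakGrad hΩ)
  have hφ0 := integral_norm_sq_sub_le h.phi_mem.1 hs.phi_mem.1
  have hu := integral_norm_sq_sub_le h.ut_mem.memLp hs.u_mem.memLp
  have e1 := h.phi_eq _ h.mu_mem
  have e2 := h.mu_eq _ (h.phi_mem.sub hs.phi_mem)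
  have e3 := h.r_eq
  have e4 := h.ut_eq _ h.ut_mem
  have e5 := h.q_eq
  have i1 : ∫ x in Ω, (s'.φ x - s.φ x) / τ * s'.μ x
      = τ⁻¹ * ∫ x in Ω, s'.μ x * (s'.φ x - s.φ x) := by
    rw [← integral_const_mul]
    congr 1 with x
    ring
  have i2 : ∫ x in Ω, inner ℝ (weakGrad Ω s'.φ x) (weakGrad Ω (fun x => s'.φ x - s.φ x) x)
      = ∫ x in Ω, inner ℝ (weakGrad Ω s'.φ x) (weakGrad Ω s'.φ x - weakGrad Ω s.φ x) := by
    refine integral_congr_ae ?_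
    filter_upwards [weakGrad_sub hΩ h.phi_mem.isWeakGrad hs.phi_mem.isWeakGrad] with x hx
    rw [hx]
  have i3 : ∫ x in Ω, F' P (s.φ x) * ((s'.φ x - s.φ x) / τ)
      = τ⁻¹ * ∫ x in Ω, F' P (s.φ x) * (s'.φ x - s.φ x) := by
    rw [← integral_const_mul]
    congr 1 with x
    ring
  have i4 : ∫ x in Ω, inner ℝ (τ⁻¹ • (ut x - s.u x)) (ut x)
      = τ⁻¹ * ∫ x in Ω, inner ℝ (ut x) (ut x - s.u x) := by
    rw [← integral_const_mul]
    congr 1 with x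
    rw [real_inner_smul_left, real_inner_comm]
  have i5 : ∫ x in Ω, inner ℝ (s'.φ x) (s'.φ x - s.φ x)
      = ∫ x in Ω, s'.φ x * (s'.φ x - s.φ x) := by
    congr 1 with x
    exact mul_comm _ _
  rw [i1] at e1
  rw [i2] at e2
  rw [i3] at e3
  rw [i4] at e4
  rw [i5] at hφ0
  simp only [real_inner_self_eq_norm_sq] at e1 e4
  simp only [Real.norm_eq_abs, sq_abs] at hφ0
  simp only [energy]
  set X := ∫ x in Ω, s'.μ x * (s'.φ x - s.φ x)
  set Y := ∫ x in Ω, F' P (s.φ x) * (s'.φ x - s.φ x)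
  set Z := ∫ x in Ω, inner ℝ (s.u x) (weakGrad Ω s.φ x) * s'.μ x
  set W := ∫ x in Ω, inner ℝ (ut x) (s.μ x • weakGrad Ω s.φ x)
  set C := ∫ x in Ω, inner ℝ (convect Ω s.u s.u x) (ut x)
  set σ := √(E1 Ω P s.φ + P.δ)
  set D₁ := ∫ x in Ω, inner ℝ (weakGrad Ω s'.φ x) (weakGrad Ω s'.φ x - weakGrad Ω s.φ x)
  set D₀ := ∫ x in Ω, s'.φ x * (s'.φ x - s.φ x)
  set U := ∫ x in Ω, inner ℝ (ut x) (ut x - s.u x)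
  set e := Real.exp (t / P.T)
  set Dμ := ∫ x in Ω, ‖weakGrad Ω s'.μ x‖ ^ 2
  set Du := ∑ i, ∫ x in Ω, ‖weakGrad Ω (fun y => ut y i) x‖ ^ 2
  set Q := ∫ x in Ω, inner ℝ (weakGrad Ω s.p x) (ut x)
  clear_value X Y Z W C σ D₁ D₀ U e Dμ Du Q
  clear i1 i2 i3 i4 i5 hs h
  -- the equations tested with the unknowns; `Y`, `Z`, `W` and `C` cancel in their sum
  have hττ : τ * τ⁻¹ = 1 := mul_inv_cancel₀ hτ.ne'
  have f1 : X + τ * (s'.r / σ * Z) = -(τ * P.M * Dμ) := by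
    linear_combination τ * e1 - X * hττ
  have f3 : 4 * s'.r * (s'.r - s.r) = 2 * (s'.r / σ) * (Y + τ * Z - τ * W) := by
    linear_combination 4 * s'.r * τ * e3 - 4 * s'.r * (s'.r - s.r) * hττ
      + 2 * s'.r / σ * Y * hττ
  have f4 : U + τ * (e * s'.q * C) + τ * (P.ν * Du) + τ * Q = τ * (s'.r / σ * W) := by
    linear_combination τ * e4 - U * hττ
  have f5 : s'.q * (s'.q - s.q) = -(τ / P.T * s'.q ^ 2) + τ * (e * s'.q * C) := by
    linear_combination s'.q * τ * e5 - s'.q * (s'.q - s.q) * hττ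
  have g1 : 2 * s'.r ^ 2 - 2 * s.r ^ 2 ≤ 4 * s'.r * (s'.r - s.r) := by
    linarith [sq_nonneg (s'.r - s.r)]
  have g2 : s'.q ^ 2 - s.q ^ 2 ≤ 2 * (s'.q * (s'.q - s.q)) := by
    linarith [sq_nonneg (s'.q - s.q)]
  have g3 := mul_le_mul_of_nonneg_left hφ0 hγ.le
  have g4 : 2 * τ / P.T * s'.q ^ 2 = 2 * (τ / P.T * s'.q ^ 2) := by ring
  rw [g4]
  linarith

end Energy

/-! ### The weak form of one step as a coupled linear problem -/

section Forms

open Filter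

variable {Ω : Set E2}

/-- The function component on a space of pairs. -/
noncomputable def valueL (S : Submodule ℝ (L2Pair Ω)) : S →L[ℝ] Lp ℝ 2 (volume.restrict Ω) :=
  (WithLp.fstL 2 ℝ _ _).comp S.subtypeL

/-- The gradient component on a space of pairs. -/
noncomputable def gradL (S : Submodule ℝ (L2Pair Ω)) : S →L[ℝ] Lp E2 2 (volume.restrict Ω) :=
  (WithLp.sndL 2 ℝ _ _).comp S.subtypeL

/-- The form `(f, h) ↦ ∫ f h`. -/
noncomputable def massForm (S : Submodule ℝ (L2Pair Ω)) : S →L[ℝ] S →L[ℝ] ℝ :=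
  (innerSL ℝ : _ →L[ℝ] _ →L[ℝ] ℝ).bilinearComp (valueL S) (valueL S)

/-- The form `(f, h) ↦ ∫ ∇f · ∇h`. -/
noncomputable def stiffForm (S : Submodule ℝ (L2Pair Ω)) : S →L[ℝ] S →L[ℝ] ℝ :=
  (innerSL ℝ : _ →L[ℝ] _ →L[ℝ] ℝ).bilinearComp (gradL S) (gradL S)

variable {S : Submodule ℝ (L2Pair Ω)}

lemma massForm_apply (x y : S) : massForm S x y = inner ℝ (x : L2Pair Ω).fst (y : L2Pair Ω).fst :=
  rfl

lemma stiffForm_apply (x y : S) :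
    stiffForm S x y = inner ℝ (x : L2Pair Ω).snd (y : L2Pair Ω).snd := rfl

lemma massForm_comm (x y : S) : massForm S x y = massForm S y x := by
  rw [massForm_apply, massForm_apply, real_inner_comm]

lemma massForm_self (x : S) : massForm S x x = ‖(x : L2Pair Ω).fst‖ ^ 2 := by
  rw [massForm_apply, real_inner_self_eq_norm_sq]

lemma stiffForm_self (x : S) : stiffForm S x x = ‖(x : L2Pair Ω).snd‖ ^ 2 := by
  rw [stiffForm_apply, real_inner_self_eq_norm_sq]

lemma massForm_add_stiffForm (x : S) : massForm S x x + stiffForm S x x = ‖x‖ ^ 2 := by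
  rw [massForm_self, stiffForm_self]
  exact (WithLp.prod_norm_sq_eq_of_L2 (x : L2Pair Ω)).symm

lemma massForm_eq_integral {x y : S} {f h : E2 → ℝ}
    (hx : (x : L2Pair Ω).fst =ᵐ[volume.restrict Ω] f)
    (hy : (y : L2Pair Ω).fst =ᵐ[volume.restrict Ω] h) :
    massForm S x y = ∫ z in Ω, f z * h z := by
  rw [massForm_apply, L2.inner_def]
  refine integral_congr_ae ?_
  filter_upwards [hx, hy] with z h1 h2
  rw [h1, h2]
  exact mul_comm _ _

lemma stiffForm_eq_integral (hΩ : IsOpen Ω) (hS : S ≤ sobolev Ω) {x y : S} {f h : E2 → ℝ}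
    (hx : (x : L2Pair Ω).fst =ᵐ[volume.restrict Ω] f)
    (hy : (y : L2Pair Ω).fst =ᵐ[volume.restrict Ω] h) :
    stiffForm S x y = ∫ z in Ω, inner ℝ (weakGrad Ω f z) (weakGrad Ω h z) := by
  rw [stiffForm_apply, L2.inner_def]
  refine integral_congr_ae ?_
  filter_upwards [snd_ae_eq_weakGrad hΩ (hS x.2) hx, snd_ae_eq_weakGrad hΩ (hS y.2) hy]
    with z h1 h2
  rw [h1, h2]

/-- A pairing that converges absolutely on `H¹(Ω)` is a bounded functional. -/
lemma exists_sobolev_pairing (hΩ : IsOpen Ω) {k : E2 → ℝ}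
    (hk : ∀ ψ, MemH1 Ω ψ → IntegrableOn (fun x => k x * ψ x) Ω) :
    ∃ l : sobolev Ω →L[ℝ] ℝ, ∀ (y : sobolev Ω) (ψ : E2 → ℝ),
      (y : L2Pair Ω).fst =ᵐ[volume.restrict Ω] ψ → l y = ∫ x in Ω, k x * ψ x := by
  have := (isClosed_sobolev hΩ).completeSpace_coe
  obtain ⟨l, hl⟩ := exists_continuous_pairing (valueL (sobolev Ω)) k (fun y => by
    have := hk (y : L2Pair Ω).fst (memH1_iff.2 ⟨y, y.2, ae_eq_rfl⟩)
    simp only [mul_comm (k _)] at this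
    exact this)
  refine ⟨l, fun y ψ hy => ?_⟩
  rw [hl]
  refine integral_congr_ae ?_
  filter_upwards [hy] with x hx
  rw [← hx]
  exact mul_comm _ _

/-- `H¹₀(Ω)²` as a Hilbert space. -/
abbrev VelocitySpace (Ω : Set E2) : Type := WithLp 2 (sobolevZero Ω × sobolevZero Ω)

/-- The vector field with the components given by an element of `H¹₀(Ω)²`. -/
noncomputable def fieldL (Ω : Set E2) : VelocitySpace Ω →L[ℝ] Lp E2 2 (volume.restrict Ω) :=
  ((ContinuousLinearMap.compLpL 2 (volume.restrict Ω)
      ((ContinuousLinearMap.id ℝ ℝ).smulRight (EuclideanSpace.single (0 : Fin 2) (1 : ℝ)))).comp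
    ((valueL (sobolevZero Ω)).comp (WithLp.fstL 2 ℝ _ _)))
  + ((ContinuousLinearMap.compLpL 2 (volume.restrict Ω)
      ((ContinuousLinearMap.id ℝ ℝ).smulRight (EuclideanSpace.single (1 : Fin 2) (1 : ℝ)))).comp
    ((valueL (sobolevZero Ω)).comp (WithLp.sndL 2 ℝ _ _)))

lemma fieldL_ae_eq (y : VelocitySpace Ω) : ∀ᵐ x ∂volume.restrict Ω,
    fieldL Ω y x 0 = (y.fst : L2Pair Ω).fst x ∧ fieldL Ω y x 1 = (y.snd : L2Pair Ω).fst x := by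
  have h1 := ContinuousLinearMap.coeFn_compLpL (p := 2) (μ := volume.restrict Ω)
    ((ContinuousLinearMap.id ℝ ℝ).smulRight (EuclideanSpace.single (0 : Fin 2) (1 : ℝ)))
    (y.fst : L2Pair Ω).fst
  have h2 := ContinuousLinearMap.coeFn_compLpL (p := 2) (μ := volume.restrict Ω)
    ((ContinuousLinearMap.id ℝ ℝ).smulRight (EuclideanSpace.single (1 : Fin 2) (1 : ℝ)))
    (y.snd : L2Pair Ω).fst
  have h3 := Lp.coeFn_add
    (ContinuousLinearMap.compLpL 2 (volume.restrict Ω)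
      ((ContinuousLinearMap.id ℝ ℝ).smulRight (EuclideanSpace.single (0 : Fin 2) (1 : ℝ)))
        (y.fst : L2Pair Ω).fst)
    (ContinuousLinearMap.compLpL 2 (volume.restrict Ω)
      ((ContinuousLinearMap.id ℝ ℝ).smulRight (EuclideanSpace.single (1 : Fin 2) (1 : ℝ)))
        (y.snd : L2Pair Ω).fst)
  filter_upwards [h1, h2, h3] with x e1 e2 e3
  have e : fieldL Ω y x = (y.fst : L2Pair Ω).fst x • EuclideanSpace.single (0 : Fin 2) (1 : ℝ)
      + (y.snd : L2Pair Ω).fst x • EuclideanSpace.single (1 : Fin 2) (1 : ℝ) := by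
    rw [Pi.add_apply, e1, e2] at e3
    exact e3
  rw [e]
  constructor <;> simp

lemma components_of_fieldL {y : VelocitySpace Ω} {w : E2 → E2}
    (h : fieldL Ω y =ᵐ[volume.restrict Ω] w) :
    (y.fst : L2Pair Ω).fst =ᵐ[volume.restrict Ω] (fun x => w x 0) ∧
      (y.snd : L2Pair Ω).fst =ᵐ[volume.restrict Ω] (fun x => w x 1) := by
  constructor
  · filter_upwards [h, fieldL_ae_eq y] with x h1 h2
    rw [← h1, h2.1]
  · filter_upwards [h, fieldL_ae_eq y] with x h1 h2
    rw [← h1, h2.2]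

lemma memH10Vec_iff (hΩ : IsOpen Ω) {w : E2 → E2} :
    MemH10Vec Ω w ↔ ∃ y : VelocitySpace Ω, fieldL Ω y =ᵐ[volume.restrict Ω] w := by
  constructor
  · intro h
    obtain ⟨x₀, hx₀, h0⟩ := (memH10_iff hΩ).1 (h 0)
    obtain ⟨x₁, hx₁, h1⟩ := (memH10_iff hΩ).1 (h 1)
    let y : VelocitySpace Ω := WithLp.toLp 2 (⟨x₀, hx₀⟩, ⟨x₁, hx₁⟩)
    refine ⟨y, ?_⟩
    filter_upwards [h0, h1, fieldL_ae_eq y] with x e0 e1 e2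
    ext i
    fin_cases i
    · exact e2.1.trans e0
    · exact e2.2.trans e1
  · rintro ⟨y, hy⟩ i
    obtain ⟨h0, h1⟩ := components_of_fieldL hy
    rw [memH10_iff hΩ]
    fin_cases i
    · exact ⟨_, y.fst.2, h0⟩
    · exact ⟨_, y.snd.2, h1⟩

instance : CompleteSpace (sobolevZero Ω) :=
  (Submodule.isClosed_topologicalClosure _).completeSpace_coe

/-- A pairing that converges absolutely on `H¹₀(Ω)²` is a bounded functional. -/
lemma exists_velocity_pairing (hΩ : IsOpen Ω) {k : E2 → E2}
    (hk : ∀ w, MemH10Vec Ω w → IntegrableOn (fun x => inner ℝ (k x) (w x)) Ω) :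
    ∃ l : VelocitySpace Ω →L[ℝ] ℝ, ∀ (y : VelocitySpace Ω) (w : E2 → E2),
      fieldL Ω y =ᵐ[volume.restrict Ω] w → l y = ∫ x in Ω, inner ℝ (k x) (w x) := by
  obtain ⟨l, hl⟩ := exists_continuous_pairing (fieldL Ω) k
    (fun y => hk _ ((memH10Vec_iff hΩ).2 ⟨y, ae_eq_rfl⟩))
  refine ⟨l, fun y w hy => ?_⟩
  rw [hl]
  refine integral_congr_ae ?_
  filter_upwards [hy] with x hx
  rw [hx]

/-- The first component of a velocity field. -/
noncomputable def firstL (Ω : Set E2) : VelocitySpace Ω →L[ℝ] sobolevZero Ω :=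
  WithLp.fstL 2 ℝ (sobolevZero Ω) (sobolevZero Ω)

/-- The second component of a velocity field. -/
noncomputable def secondL (Ω : Set E2) : VelocitySpace Ω →L[ℝ] sobolevZero Ω :=
  WithLp.sndL 2 ℝ (sobolevZero Ω) (sobolevZero Ω)

/-- The form `(f, h) ↦ ∫ f h + κ ∫ ∇f · ∇h` on `H¹₀(Ω)`. -/
noncomputable def componentForm (Ω : Set E2) (κ : ℝ) :
    sobolevZero Ω →L[ℝ] sobolevZero Ω →L[ℝ] ℝ :=
  massForm (sobolevZero Ω) + κ • stiffForm (sobolevZero Ω)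

/-- The form `(v, w) ↦ ∫ v · w + κ ∫ ∇v : ∇w` of the implicit velocity equation. -/
noncomputable def velocityForm (Ω : Set E2) (κ : ℝ) :
    VelocitySpace Ω →L[ℝ] VelocitySpace Ω →L[ℝ] ℝ :=
  (componentForm Ω κ).bilinearComp (firstL Ω) (firstL Ω)
    + (componentForm Ω κ).bilinearComp (secondL Ω) (secondL Ω)

lemma velocityForm_apply (κ : ℝ) (y z : VelocitySpace Ω) : velocityForm Ω κ y z
    = (massForm _ y.fst z.fst + κ * stiffForm _ y.fst z.fst)
      + (massForm _ y.snd z.snd + κ * stiffForm _ y.snd z.snd) := by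
  simp only [velocityForm, add_apply, ContinuousLinearMap.bilinearComp_apply,
    componentForm, smul_apply, smul_eq_mul]
  rfl

lemma le_componentForm_self {κ : ℝ} (x : sobolevZero Ω) :
    min 1 κ * ‖x‖ ^ 2 ≤ massForm _ x x + κ * stiffForm _ x x := by
  rw [← massForm_add_stiffForm, mul_add]
  have h1 : 0 ≤ massForm _ x x := by rw [massForm_self]; positivity
  have h2 : 0 ≤ stiffForm _ x x := by rw [stiffForm_self]; positivity
  exact add_le_add (mul_le_of_le_one_left h1 (min_le_left 1 κ))
    (mul_le_mul_of_nonneg_right (min_le_right 1 κ) h2)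

lemma velocityForm_coercive {κ : ℝ} (hκ : 0 < κ) : IsCoercive (velocityForm Ω κ) := by
  refine ⟨min 1 κ, lt_min one_pos hκ, fun y => ?_⟩
  have key : ∀ n a b m A B : ℝ, n ^ 2 = a ^ 2 + b ^ 2 → m * a ^ 2 ≤ A → m * b ^ 2 ≤ B →
      m * n * n ≤ A + B := by
    intro n a b m A B hn h1 h2
    rw [mul_assoc, ← sq, hn, mul_add]
    exact add_le_add h1 h2
  rw [velocityForm_apply]
  exact key _ _ _ _ _ _ (WithLp.prod_norm_sq_eq_of_L2 y) (le_componentForm_self y.fst)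
    (le_componentForm_self y.snd)

lemma integral_inner_eq_add {v w : E2 → E2} (hv : MemH10Vec Ω v) (hw : MemH10Vec Ω w) :
    ∫ x in Ω, inner ℝ (v x) (w x) = (∫ x in Ω, v x 0 * w x 0) + ∫ x in Ω, v x 1 * w x 1 := by
  have hi : ∀ i, Integrable (fun x => v x i * w x i) (volume.restrict Ω) := fun i =>
    (hv i).1.1.integrable_mul (hw i).1.1
  rw [← integral_add (hi 0) (hi 1)]
  congr 1 with x
  simp [PiLp.inner_apply, mul_comm]

lemma velocityForm_eq_integral (hΩ : IsOpen Ω) (κ : ℝ) {y z : VelocitySpace Ω} {v w : E2 → E2}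
    (hy : fieldL Ω y =ᵐ[volume.restrict Ω] v) (hz : fieldL Ω z =ᵐ[volume.restrict Ω] w) :
    velocityForm Ω κ y z = (∫ x in Ω, inner ℝ (v x) (w x))
      + κ * (∑ i, ∫ x in Ω,
          inner ℝ (weakGrad Ω (fun y => v y i) x) (weakGrad Ω (fun y => w y i) x)) := by
  have hy' := components_of_fieldL hy
  have hz' := components_of_fieldL hz
  have hv := (memH10Vec_iff hΩ).2 ⟨y, hy⟩
  have hw := (memH10Vec_iff hΩ).2 ⟨z, hz⟩
  have hm := integral_inner_eq_add hv hw
  have e0 := massForm_eq_integral hy'.1 hz'.1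
  have e1 := massForm_eq_integral hy'.2 hz'.2
  have e2 := stiffForm_eq_integral hΩ (sobolevZero_le hΩ) hy'.1 hz'.1
  have e3 := stiffForm_eq_integral hΩ (sobolevZero_le hΩ) hy'.2 hz'.2
  have h := velocityForm_apply κ y z
  simp only [Fin.sum_univ_two]
  linear_combination h + e0 + e1 + κ * e2 + κ * e3 - hm

end Forms

/-! ### Solvability of one step -/

section Solvability

open Filter

variable {Ω : Set E2}

/-- The equations of one step that involve only the phase function, the chemical potential, the
intermediate velocity and the two scalar unknowns. -/
structure SolvesDecoupled (Ω : Set E2) (P : Params) (τ t : ℝ) (s : State) (φ μ : E2 → ℝ)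
    (ut : E2 → E2) (r q : ℝ) : Prop where
  phi_eq : ∀ ψ, MemH1 Ω ψ →
    (∫ x in Ω, (φ x - s.φ x) / τ * ψ x)
      + r / √(E1 Ω P s.φ + P.δ) * (∫ x in Ω, inner ℝ (s.u x) (weakGrad Ω s.φ x) * ψ x)
      = -P.M * ∫ x in Ω, inner ℝ (weakGrad Ω μ x) (weakGrad Ω ψ x)
  mu_eq : ∀ ψ, MemH1 Ω ψ →
    (∫ x in Ω, μ x * ψ x)
      = (∫ x in Ω, inner ℝ (weakGrad Ω φ x) (weakGrad Ω ψ x))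
        + P.γ * (∫ x in Ω, φ x * ψ x)
        + r / √(E1 Ω P s.φ + P.δ) * (∫ x in Ω, F' P (s.φ x) * ψ x)
  r_eq : (r - s.r) / τ
      = 1 / (2 * √(E1 Ω P s.φ + P.δ)) *
        ((∫ x in Ω, F' P (s.φ x) * ((φ x - s.φ x) / τ))
          + (∫ x in Ω, inner ℝ (s.u x) (weakGrad Ω s.φ x) * μ x)
          - (∫ x in Ω, inner ℝ (ut x) (s.μ x • weakGrad Ω s.φ x)))
  ut_eq : ∀ w, MemH10Vec Ω w →
    (∫ x in Ω, inner ℝ (τ⁻¹ • (ut x - s.u x)) (w x))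
      + Real.exp (t / P.T) * q * (∫ x in Ω, inner ℝ (convect Ω s.u s.u x) (w x))
      + P.ν * (∑ i, ∫ x in Ω,
          inner ℝ (weakGrad Ω (fun y => ut y i) x) (weakGrad Ω (fun y => w y i) x))
      + (∫ x in Ω, inner ℝ (weakGrad Ω s.p x) (w x))
      = r / √(E1 Ω P s.φ + P.δ) * (∫ x in Ω, inner ℝ (w x) (s.μ x • weakGrad Ω s.φ x))
  q_eq : (q - s.q) / τ
      = -(1 / P.T) * q + Real.exp (t / P.T) * (∫ x in Ω, inner ℝ (convect Ω s.u s.u x) (ut x))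

lemma IsStep.solvesDecoupled {P : Params} {τ t : ℝ} {s s' : State} {ut : E2 → E2}
    (h : IsStep Ω P τ t s ut s') : SolvesDecoupled Ω P τ t s s'.φ s'.μ ut s'.r s'.q :=
  ⟨h.phi_eq, h.mu_eq, h.r_eq, h.ut_eq, h.q_eq⟩

/-- The bounded functionals that the data of a step define on the Hilbert spaces. -/
structure IsStepData (Ω : Set E2) (P : Params) (τ : ℝ) (s : State)
    (f a l : sobolev Ω →L[ℝ] ℝ) (k c l' : VelocitySpace Ω →L[ℝ] ℝ) : Prop where
  f_eq : ∀ (χ : sobolev Ω) (ψ : E2 → ℝ), (χ : L2Pair Ω).fst =ᵐ[volume.restrict Ω] ψ →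
    f χ = ∫ x in Ω, F' P (s.φ x) * ψ x
  a_eq : ∀ (χ : sobolev Ω) (ψ : E2 → ℝ), (χ : L2Pair Ω).fst =ᵐ[volume.restrict Ω] ψ →
    a χ = ∫ x in Ω, inner ℝ (s.u x) (weakGrad Ω s.φ x) * ψ x
  l_eq : ∀ (χ : sobolev Ω) (ψ : E2 → ℝ), (χ : L2Pair Ω).fst =ᵐ[volume.restrict Ω] ψ →
    l χ = ∫ x in Ω, s.φ x * ψ x
  k_eq : ∀ (v : VelocitySpace Ω) (w : E2 → E2), fieldL Ω v =ᵐ[volume.restrict Ω] w →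
    k v = ∫ x in Ω, inner ℝ (w x) (s.μ x • weakGrad Ω s.φ x)
  c_eq : ∀ (v : VelocitySpace Ω) (w : E2 → E2), fieldL Ω v =ᵐ[volume.restrict Ω] w →
    c v = ∫ x in Ω, inner ℝ (convect Ω s.u s.u x) (w x)
  l'_eq : ∀ (v : VelocitySpace Ω) (w : E2 → E2), fieldL Ω v =ᵐ[volume.restrict Ω] w →
    l' v = ∫ x in Ω, inner ℝ (s.u x - τ • weakGrad Ω s.p x) (w x)

lemma exists_isStepData (hΩ : IsOpen Ω) {P : Params} (τ : ℝ) {s : State} (hs : Admissible Ω P s) :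
    ∃ f a l k c l', IsStepData Ω P τ s f a l k c l' := by
  have h₁ := exists_sobolev_pairing hΩ (k := fun x => F' P (s.φ x)) hs.F'_pairing
  have h₂ := exists_sobolev_pairing hΩ (k := fun x => inner ℝ (s.u x) (weakGrad Ω s.φ x))
    hs.advection_pairing
  have h₃ := exists_sobolev_pairing hΩ (k := s.φ) fun ψ hψ => hs.phi_mem.1.integrable_mul hψ.1
  have h₄ := exists_velocity_pairing hΩ (k := fun x => s.μ x • weakGrad Ω s.φ x) fun w hw => by
    have := hs.capillary_pairing w hw
    simpa only [real_inner_comm] using this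
  have h₅ := exists_velocity_pairing hΩ (k := fun x => convect Ω s.u s.u x) hs.convection_pairing
  have h₆ := exists_velocity_pairing hΩ (k := fun x => s.u x - τ • weakGrad Ω s.p x) fun w hw =>
    integrable_inner_of_memLp
      (hs.u_mem.memLp.sub ((hs.p_mem.memLp_weakGrad hΩ).const_smul τ)) hw.memLp
  refine h₁.elim fun f hf => h₂.elim fun a ha => h₃.elim fun l hl => h₄.elim fun k hk =>
    h₅.elim fun c hc => h₆.elim fun l' hl' => ⟨f, a, l, k, c, l', ⟨hf, ha, hl, ?_, hc, hl'⟩⟩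
  intro v w hv
  refine (hk v w hv).trans ?_
  simp only [real_inner_comm]

/-- Arithmetic of the equation for the phase function: `A`, `B`, `C` stand for the integrals in
the scheme, small letters for values of forms and functionals, primed ones for rescaled functionals.
The lemmas for the other equations follow the same convention. -/
lemma phase_equation_iff {τ σ r M A B C m l a b d : ℝ} (hτ : 0 < τ) (e₁ : A = τ⁻¹ * (m - l))
    (e₂ : b = B) (e₃ : d = C) (e₄ : a = τ * σ⁻¹ * b) :
    A + r / σ * B = -M * C ↔ m + r * a + τ * M * d = l := by
  have hττ : τ * τ⁻¹ = 1 := mul_inv_cancel₀ hτ.ne'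
  subst e₁ e₂ e₃ e₄
  constructor
  · intro h
    linear_combination τ * h - (m - l) * hττ
  · intro h
    linear_combination τ⁻¹ * h - (r * σ⁻¹ * b + M * d) * hττ

lemma potential_equation_iff {σ r γ X D Y F x d y f f' : ℝ} (e₁ : x = X) (e₂ : d = D) (e₃ : y = Y)
    (e₄ : f = F) (e₅ : f' = σ⁻¹ * f) :
    X = D + γ * Y + r / σ * F ↔ d + γ * y + r * f' = x := by
  subst e₁ e₂ e₃ e₄ e₅
  constructor <;> intro h <;> linear_combination -h

lemma auxiliary_equation_iff {τ σ r r₀ F A K f f₀ a k f' a' k' : ℝ} (hτ : 0 < τ)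
    (e₁ : F = τ⁻¹ * (f - f₀)) (e₂ : a = A) (e₃ : k = K) (e₄ : f' = σ⁻¹ * f)
    (e₅ : a' = τ * σ⁻¹ * a) (e₆ : k' = τ * σ⁻¹ * k) :
    (r - r₀) / τ = 1 / (2 * σ) * (F + A - K) ↔
      2 * r - (f' + a' - k') = 2 * r₀ - σ⁻¹ * f₀ := by
  have hττ : τ * τ⁻¹ = 1 := mul_inv_cancel₀ hτ.ne'
  subst e₁ e₂ e₃ e₄ e₅ e₆
  constructor
  · intro h
    linear_combination 2 * τ * h - (2 * (r - r₀) - σ⁻¹ * (f - f₀)) * hττ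
  · intro h
    linear_combination τ⁻¹ / 2 * h + σ⁻¹ / 2 * (a - k) * hττ

lemma velocity_equation_iff {τ σ r q e ν I G N D K C b l c k c' k' : ℝ} (hτ : 0 < τ)
    (e₁ : I + G = τ⁻¹ * (N - l)) (e₂ : b = N + τ * ν * D) (e₃ : c = C) (e₄ : k = K)
    (e₅ : c' = τ * e * c) (e₆ : k' = τ * σ⁻¹ * k) :
    I + e * q * C + ν * D + G = r / σ * K ↔ b + q * c' - r * k' = l := by
  have hττ : τ * τ⁻¹ = 1 := mul_inv_cancel₀ hτ.ne'
  subst e₂ e₃ e₄ e₅ e₆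
  constructor
  · intro h
    linear_combination τ * h - τ * e₁ - (N - l) * hττ
  · intro h
    linear_combination τ⁻¹ * h + e₁ - (ν * D + e * q * c - r * σ⁻¹ * k) * hττ

lemma scalar_equation_iff {τ T q q₀ e C c c' : ℝ} (hτ : 0 < τ) (e₁ : c = C)
    (e₂ : c' = τ * e * c) :
    (q - q₀) / τ = -(1 / T) * q + e * C ↔ (1 + τ / T) * q - c' = q₀ := by
  have hττ : τ * τ⁻¹ = 1 := mul_inv_cancel₀ hτ.ne'
  subst e₁ e₂
  constructor
  · intro h
    linear_combination τ * h - (q - q₀) * hττ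
  · intro h
    linear_combination τ⁻¹ * h - (1 / T * q - e * c) * hττ

/-- The difference quotient of the phase function, tested with `ψ`. -/
lemma IsStepData.integral_difference_quotient {P : Params} {τ : ℝ} {s : State}
    {f a l : sobolev Ω →L[ℝ] ℝ} {k c l' : VelocitySpace Ω →L[ℝ] ℝ}
    (hd : IsStepData Ω P τ s f a l k c l') (hs : Admissible Ω P s) {x χ : sobolev Ω}
    {φ ψ : E2 → ℝ} (hx : (x : L2Pair Ω).fst =ᵐ[volume.restrict Ω] φ)
    (hχ : (χ : L2Pair Ω).fst =ᵐ[volume.restrict Ω] ψ) :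
    ∫ x in Ω, (φ x - s.φ x) / τ * ψ x = τ⁻¹ * (massForm (sobolev Ω) x χ - l χ) := by
  have hφ : MemH1 Ω φ := memH1_iff.2 ⟨x, x.2, hx⟩
  have hψ : MemH1 Ω ψ := memH1_iff.2 ⟨χ, χ.2, hχ⟩
  have e₁ := massForm_eq_integral hx hχ
  have e₂ := hd.l_eq χ ψ hχ
  have e₃ := integral_sub (hφ.1.integrable_mul hψ.1) (hs.phi_mem.1.integrable_mul hψ.1)
  have e₄ : ∫ x in Ω, (φ x - s.φ x) / τ * ψ x = τ⁻¹ * ∫ x in Ω, (φ x * ψ x - s.φ x * ψ x) := by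
    refine Eq.trans ?_ (integral_const_mul _ _)
    congr 1 with x
    ring
  simp only [Pi.mul_apply] at e₃
  exact e₄.trans (congrArg (τ⁻¹ * ·) (e₃.trans (congrArg₂ (· - ·) e₁.symm e₂.symm)))

/-- The derivative of the nonlinear energy, tested with the difference quotient. -/
lemma IsStepData.integral_mul_difference_quotient {P : Params} {τ : ℝ} {s : State}
    {f a l : sobolev Ω →L[ℝ] ℝ} {k c l' : VelocitySpace Ω →L[ℝ] ℝ}
    (hd : IsStepData Ω P τ s f a l k c l') (hs : Admissible Ω P s) {x z : sobolev Ω}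
    {φ : E2 → ℝ} (hx : (x : L2Pair Ω).fst =ᵐ[volume.restrict Ω] φ)
    (hz : (z : L2Pair Ω).fst =ᵐ[volume.restrict Ω] s.φ) :
    ∫ x in Ω, F' P (s.φ x) * ((φ x - s.φ x) / τ) = τ⁻¹ * (f x - f z) := by
  have hφ : MemH1 Ω φ := memH1_iff.2 ⟨x, x.2, hx⟩
  have e₃ := integral_sub (hs.F'_pairing _ hφ) (hs.F'_pairing _ hs.phi_mem)
  have e₄ : ∫ x in Ω, F' P (s.φ x) * ((φ x - s.φ x) / τ)
      = τ⁻¹ * ∫ x in Ω, (F' P (s.φ x) * φ x - F' P (s.φ x) * s.φ x) := by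
    refine Eq.trans ?_ (integral_const_mul _ _)
    congr 1 with x
    ring
  exact e₄.trans (congrArg (τ⁻¹ * ·)
    (e₃.trans (congrArg₂ (· - ·) (hd.f_eq x φ hx).symm (hd.f_eq z s.φ hz).symm)))

/-- The explicit terms of the momentum equation, tested with `w`. -/
lemma IsStepData.integral_velocity_data (hΩ : IsOpen Ω) {P : Params} {τ : ℝ} {s : State}
    (hτ : 0 < τ) {f a l : sobolev Ω →L[ℝ] ℝ} {k c l' : VelocitySpace Ω →L[ℝ] ℝ}
    (hd : IsStepData Ω P τ s f a l k c l') (hs : Admissible Ω P s) {v : VelocitySpace Ω}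
    {ut w : E2 → E2} (hut : MemH10Vec Ω ut) (hv : fieldL Ω v =ᵐ[volume.restrict Ω] w) :
    (∫ x in Ω, inner ℝ (τ⁻¹ • (ut x - s.u x)) (w x))
        + (∫ x in Ω, inner ℝ (weakGrad Ω s.p x) (w x))
      = τ⁻¹ * ((∫ x in Ω, inner ℝ (ut x) (w x)) - l' v) := by
  have hττ : τ * τ⁻¹ = 1 := mul_inv_cancel₀ hτ.ne'
  have hgp := hs.p_mem.memLp_weakGrad hΩ
  have hum := hs.u_mem.memLp
  have hw : MemH10Vec Ω w := (memH10Vec_iff hΩ).2 ⟨v, hv⟩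
  have e₁ := hd.l'_eq v w hv
  have e₂ := integral_sub (integrable_inner_of_memLp hut.memLp hw.memLp)
      (integrable_inner_of_memLp (hum.sub (hgp.const_smul τ)) hw.memLp)
  have e₃ := integral_add
      (integrable_inner_of_memLp ((hut.memLp.sub hum).const_smul τ⁻¹) hw.memLp)
      (integrable_inner_of_memLp hgp hw.memLp)
  have e₄ : ∫ x in Ω, (inner ℝ (τ⁻¹ • (ut x - s.u x)) (w x)
        + inner ℝ (weakGrad Ω s.p x) (w x))
      = τ⁻¹ * ∫ x in Ω, (inner ℝ (ut x) (w x)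
        - inner ℝ (s.u x - τ • weakGrad Ω s.p x) (w x)) := by
    refine Eq.trans ?_ (integral_const_mul _ _)
    congr 1 with x
    simp only [inner_sub_left, real_inner_smul_left]
    linear_combination (-(inner ℝ (weakGrad Ω s.p x) (w x))) * hττ
  simp only [Pi.sub_apply, Pi.smul_apply] at e₂ e₃
  exact e₃.symm.trans (e₄.trans
    (congrArg (τ⁻¹ * ·) (e₂.trans (congrArg₂ (· - ·) rfl e₁.symm))))

/-- In terms of elements of the Hilbert spaces, the decoupled equations are a coupled linear
problem: the equation for `φ` is multiplied by `τ`, that for `r` by `2τ`, and those for the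
velocity and for `q` by `τ`. -/
lemma IsStepData.solvesDecoupled_iff (hΩ : IsOpen Ω) {P : Params} {τ t : ℝ} {s : State}
    (hτ : 0 < τ) (hs : Admissible Ω P s)
    {f a l : sobolev Ω →L[ℝ] ℝ} {k c l' : VelocitySpace Ω →L[ℝ] ℝ}
    (hd : IsStepData Ω P τ s f a l k c l') {z : sobolev Ω}
    (hz : (z : L2Pair Ω).fst =ᵐ[volume.restrict Ω] s.φ) {f' a' : sobolev Ω →L[ℝ] ℝ}
    {k' c' : VelocitySpace Ω →L[ℝ] ℝ} (hf : ∀ χ, f' χ = (√(E1 Ω P s.φ + P.δ))⁻¹ * f χ)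
    (ha : ∀ χ, a' χ = τ * (√(E1 Ω P s.φ + P.δ))⁻¹ * a χ)
    (hk : ∀ v, k' v = τ * (√(E1 Ω P s.φ + P.δ))⁻¹ * k v)
    (hc : ∀ v, c' v = τ * Real.exp (t / P.T) * c v)
    {x₁ x₂ : sobolev Ω} {y : VelocitySpace Ω} {r q : ℝ} {φ μ : E2 → ℝ} {ut : E2 → E2}
    (hx₁ : (x₁ : L2Pair Ω).fst =ᵐ[volume.restrict Ω] φ)
    (hx₂ : (x₂ : L2Pair Ω).fst =ᵐ[volume.restrict Ω] μ)
    (hy : fieldL Ω y =ᵐ[volume.restrict Ω] ut) :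
    SolvesDecoupled Ω P τ t s φ μ ut r q ↔
      IsCoupledSolution (massForm (sobolev Ω)) (stiffForm (sobolev Ω))
        (velocityForm Ω (τ * P.ν)) f' a' l k' c' l' (τ * P.M) P.γ (1 + τ / P.T)
        (2 * s.r - (√(E1 Ω P s.φ + P.δ))⁻¹ * f z) s.q x₁ x₂ y r q := by
  have hut : MemH10Vec Ω ut := (memH10Vec_iff hΩ).2 ⟨y, hy⟩
  have i₁ := fun (χ : sobolev Ω) (ψ : E2 → ℝ)
      (hχ : (χ : L2Pair Ω).fst =ᵐ[volume.restrict Ω] ψ) =>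
    phase_equation_iff (r := r) (M := P.M) hτ (hd.integral_difference_quotient hs hx₁ hχ)
      (hd.a_eq χ ψ hχ) (stiffForm_eq_integral hΩ le_rfl hx₂ hχ) (ha χ)
  have i₂ := fun (χ : sobolev Ω) (ψ : E2 → ℝ)
      (hχ : (χ : L2Pair Ω).fst =ᵐ[volume.restrict Ω] ψ) =>
    potential_equation_iff (r := r) (γ := P.γ) (massForm_eq_integral hx₂ hχ)
      (stiffForm_eq_integral hΩ le_rfl hx₁ hχ) (massForm_eq_integral hx₁ hχ)
      (hd.f_eq χ ψ hχ) (hf χ)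
  have i₃ := fun (v : VelocitySpace Ω) (w : E2 → E2) (hv : fieldL Ω v =ᵐ[volume.restrict Ω] w) =>
    velocity_equation_iff (r := r) (q := q) hτ
      (hd.integral_velocity_data hΩ hτ hs hut hv)
      (velocityForm_eq_integral hΩ (τ * P.ν) hy hv) (hd.c_eq v w hv) (hd.k_eq v w hv) (hc v) (hk v)
  have i₄ := auxiliary_equation_iff (r := r) (r₀ := s.r) hτ
    (hd.integral_mul_difference_quotient hs hx₁ hz) (hd.a_eq x₂ μ hx₂) (hd.k_eq y ut hy)
    (hf x₁) (ha x₂) (hk y)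
  have i₅ := scalar_equation_iff (T := P.T) (q := q) (q₀ := s.q) hτ (hd.c_eq y ut hy) (hc y)
  constructor
  · intro h
    exact ⟨fun χ => (i₁ χ _ ae_eq_rfl).1 (h.phi_eq _ (memH1_iff.2 ⟨χ, χ.2, ae_eq_rfl⟩)),
      fun ψ => (i₂ ψ _ ae_eq_rfl).1 (h.mu_eq _ (memH1_iff.2 ⟨ψ, ψ.2, ae_eq_rfl⟩)),
      fun v => (i₃ v _ ae_eq_rfl).1 (h.ut_eq _ ((memH10Vec_iff hΩ).2 ⟨v, ae_eq_rfl⟩)),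
      i₄.1 h.r_eq, i₅.1 h.q_eq⟩
  · intro h
    refine ⟨fun ψ hψ => ?_, fun ψ hψ => ?_, i₄.2 h.aux_r, fun w hw => ?_, i₅.2 h.aux_q⟩
    · obtain ⟨χ, hχS, hχ⟩ := memH1_iff.1 hψ
      exact (i₁ ⟨χ, hχS⟩ ψ hχ).2 (h.phi _)
    · obtain ⟨χ, hχS, hχ⟩ := memH1_iff.1 hψ
      exact (i₂ ⟨χ, hχS⟩ ψ hχ).2 (h.mu _)
    · obtain ⟨v, hv⟩ := (memH10Vec_iff hΩ).1 hw
      exact (i₃ v w hv).2 (h.vel v)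

/-- The coupled linear problem of a step is the same for all representatives of the unknowns, and
its data do not depend on the unknowns. -/
lemma exists_solvesDecoupled_iff (hΩ : IsOpen Ω) {P : Params} {τ t : ℝ} {s : State} (hτ : 0 < τ)
    (hs : Admissible Ω P s) :
    ∃ (f a l : sobolev Ω →L[ℝ] ℝ) (k c l' : VelocitySpace Ω →L[ℝ] ℝ) (r₀ q₀ : ℝ),
      ∀ (x₁ x₂ : sobolev Ω) (y : VelocitySpace Ω) (r q : ℝ) (φ μ : E2 → ℝ) (ut : E2 → E2),
        (x₁ : L2Pair Ω).fst =ᵐ[volume.restrict Ω] φ →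
        (x₂ : L2Pair Ω).fst =ᵐ[volume.restrict Ω] μ →
        fieldL Ω y =ᵐ[volume.restrict Ω] ut →
        (SolvesDecoupled Ω P τ t s φ μ ut r q ↔
          IsCoupledSolution (massForm (sobolev Ω)) (stiffForm (sobolev Ω))
            (velocityForm Ω (τ * P.ν)) f a l k c l' (τ * P.M) P.γ (1 + τ / P.T) r₀ q₀
            x₁ x₂ y r q) := by
  obtain ⟨z, hzS, hz⟩ := memH1_iff.1 hs.phi_mem
  refine (exists_isStepData hΩ τ hs).elim fun f h => h.elim fun a h => h.elim fun l h =>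
    h.elim fun k h => h.elim fun c h => h.elim fun l' hd => ?_
  exact ⟨(√(E1 Ω P s.φ + P.δ))⁻¹ • f, (τ * (√(E1 Ω P s.φ + P.δ))⁻¹) • a, l,
    (τ * (√(E1 Ω P s.φ + P.δ))⁻¹) • k, (τ * Real.exp (t / P.T)) • c, l',
    2 * s.r - (√(E1 Ω P s.φ + P.δ))⁻¹ * f ⟨z, hzS⟩, s.q,
    fun x₁ x₂ y r q φ μ ut hx₁ hx₂ hy => hd.solvesDecoupled_iff hΩ hτ hs (z := ⟨z, hzS⟩) hz
      (fun _ => rfl) (fun _ => rfl) (fun _ => rfl) (fun _ => rfl) hx₁ hx₂ hy⟩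

/-- The decoupled equations have a solution, unique up to null sets. -/
lemma exists_unique_solvesDecoupled (hΩ : IsOpen Ω) {P : Params} {τ t : ℝ} {s : State} (hτ : 0 < τ)
    (hM : 0 < P.M) (hν : 0 < P.ν) (hγ : 0 < P.γ) (hT : 0 < P.T) (hs : Admissible Ω P s) :
    ∃ (φ μ : E2 → ℝ) (ut : E2 → E2) (r q : ℝ), MemH1 Ω φ ∧ MemH1 Ω μ ∧ MemH10Vec Ω ut ∧
      SolvesDecoupled Ω P τ t s φ μ ut r q ∧
      ∀ (φ₂ μ₂ : E2 → ℝ) (ut₂ : E2 → E2) (r₂ q₂ : ℝ), MemH1 Ω φ₂ → MemH1 Ω μ₂ → MemH10Vec Ω ut₂ →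
        SolvesDecoupled Ω P τ t s φ₂ μ₂ ut₂ r₂ q₂ →
        φ₂ =ᵐ[volume.restrict Ω] φ ∧ μ₂ =ᵐ[volume.restrict Ω] μ ∧
          ut₂ =ᵐ[volume.restrict Ω] ut ∧ r₂ = r ∧ q₂ = q := by
  have := (isClosed_sobolev hΩ).completeSpace_coe
  obtain ⟨f, a, l, k, c, l', r₀, q₀, hiff⟩ := exists_solvesDecoupled_iff (t := t) hΩ hτ hs
  have hTτ : 0 < 1 + τ / P.T := by positivity
  obtain ⟨x₁, x₂, y, r, q, hsol, huniq⟩ := exists_unique_isCoupledSolution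
    (massForm (sobolev Ω)) (stiffForm (sobolev Ω)) (velocityForm Ω (τ * P.ν)) f a l k c l' r₀ q₀
    (mul_pos hτ hM) hγ hTτ massForm_comm
    (fun x => by rw [massForm_self]; positivity) (fun x => by rw [stiffForm_self]; positivity)
    massForm_add_stiffForm (velocityForm_coercive (mul_pos hτ hν))
  refine ⟨(x₁ : L2Pair Ω).fst, (x₂ : L2Pair Ω).fst, fieldL Ω y, r, q,
    memH1_iff.2 ⟨x₁, x₁.2, ae_eq_rfl⟩, memH1_iff.2 ⟨x₂, x₂.2, ae_eq_rfl⟩,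
    (memH10Vec_iff hΩ).2 ⟨y, ae_eq_rfl⟩,
    (hiff x₁ x₂ y r q _ _ _ ae_eq_rfl ae_eq_rfl ae_eq_rfl).2 hsol, ?_⟩
  intro φ₂ μ₂ ut₂ r₂ q₂ hφ₂ hμ₂ hut₂ h₂
  obtain ⟨z₁, hz₁S, hz₁⟩ := memH1_iff.1 hφ₂
  obtain ⟨z₂, hz₂S, hz₂⟩ := memH1_iff.1 hμ₂
  obtain ⟨y₂, hy₂⟩ := (memH10Vec_iff hΩ).1 hut₂
  obtain ⟨e1, e2, e3, e4, e5⟩ := huniq _ _ _ _ _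
    ((hiff ⟨z₁, hz₁S⟩ ⟨z₂, hz₂S⟩ y₂ r₂ q₂ φ₂ μ₂ ut₂ hz₁ hz₂ hy₂).1 h₂)
  refine ⟨?_, ?_, ?_, e4, e5⟩
  · rw [← e1]
    exact hz₁.symm
  · rw [← e2]
    exact hz₂.symm
  · rw [← e3]
    exact hy₂.symm

/-- Two results of the pressure correction of the same intermediate velocity agree, since the
difference of the velocities is both solenoidal and a gradient. -/
lemma pressure_correction_unique (hΩ : IsOpen Ω) (hc : IsConnected Ω) {τ : ℝ} (hτ : 0 < τ)
    {p : E2 → ℝ} (hp : MemPressure Ω p) {ut₁ ut₂ u₁ u₂ : E2 → E2} {p₁ p₂ : E2 → ℝ}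
    (hut : ut₁ =ᵐ[volume.restrict Ω] ut₂) (hu₁ : MemH Ω u₁) (hu₂ : MemH Ω u₂)
    (hp₁ : MemPressure Ω p₁) (hp₂ : MemPressure Ω p₂)
    (h₁ : ∀ᵐ x ∂(volume.restrict Ω), τ⁻¹ • (u₁ x - ut₁ x) + weakGrad Ω (fun y => p₁ y - p y) x = 0)
    (h₂ : ∀ᵐ x ∂(volume.restrict Ω), τ⁻¹ • (u₂ x - ut₂ x) + weakGrad Ω (fun y => p₂ y - p y) x = 0) :
    u₁ =ᵐ[volume.restrict Ω] u₂ ∧ ∃ c : ℝ, ∀ᵐ x ∂(volume.restrict Ω), p₁ x = p₂ x + c := by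
  have hpp := hp₁.sub hp₂
  have hd : ∀ᵐ x ∂(volume.restrict Ω),
      u₁ x - u₂ x = (-τ) • weakGrad Ω (fun y => p₁ y - p₂ y) x := by
    filter_upwards [h₁, h₂, hut, weakGrad_sub hΩ hp₁.isWeakGrad hp.isWeakGrad,
      weakGrad_sub hΩ hp₂.isWeakGrad hp.isWeakGrad,
      weakGrad_sub hΩ hp₁.isWeakGrad hp₂.isWeakGrad] with x e₁ e₂ e₃ e₄ e₅ e₆
    rw [e₄] at e₁
    rw [e₅] at e₂
    rw [e₆]
    have e : τ • ((τ⁻¹ • (u₁ x - ut₁ x) + (weakGrad Ω p₁ x - weakGrad Ω p x))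
        - (τ⁻¹ • (u₂ x - ut₂ x) + (weakGrad Ω p₂ x - weakGrad Ω p x))) = 0 := by
      rw [e₁, e₂, sub_zero, smul_zero]
    rw [e₃, smul_sub, smul_add, smul_add, smul_smul, smul_smul, mul_inv_cancel₀ hτ.ne', one_smul,
      one_smul] at e
    rw [neg_smul, ← sub_eq_zero, ← e]
    simp only [smul_sub]
    abel
  have hu : u₁ =ᵐ[volume.restrict Ω] u₂ := by
    have i₁ := hu₁.2 _ hpp
    have i₂ := hu₂.2 _ hpp
    have hg := hpp.memLp_weakGrad hΩ
    have i₃ : ∫ x in Ω, ‖u₁ x - u₂ x‖ ^ 2 = 0 := by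
      have : ∫ x in Ω, ‖u₁ x - u₂ x‖ ^ 2 = (-τ) * ((∫ x in Ω,
          inner ℝ (u₁ x) (weakGrad Ω (fun y => p₁ y - p₂ y) x))
          - ∫ x in Ω, inner ℝ (u₂ x) (weakGrad Ω (fun y => p₁ y - p₂ y) x)) := by
        rw [← integral_sub (integrable_inner_of_memLp hu₁.1 hg)
          (integrable_inner_of_memLp hu₂.1 hg), ← integral_const_mul]
        refine integral_congr_ae ?_
        filter_upwards [hd] with x hx
        rw [← inner_sub_left, ← inner_smul_right, ← hx, real_inner_self_eq_norm_sq]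
      rw [this, i₁, i₂, sub_zero, mul_zero]
    have i₄ : Integrable (fun x => ‖u₁ x - u₂ x‖ ^ 2) (volume.restrict Ω) :=
      integrable_norm_sq_of_memLp (hu₁.1.sub hu₂.1)
    rw [integral_eq_zero_iff_of_nonneg (fun x => by positivity) i₄] at i₃
    filter_upwards [i₃] with x hx
    have : ‖u₁ x - u₂ x‖ ^ 2 = 0 := hx
    exact sub_eq_zero.1 (norm_eq_zero.1 (pow_eq_zero_iff two_ne_zero |>.1 this))
  refine ⟨hu, ?_⟩
  have hzero : IsWeakGrad Ω (fun y => p₁ y - p₂ y) (fun _ => 0) := by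
    refine hpp.isWeakGrad.congr ae_eq_rfl ?_
    filter_upwards [hd, hu] with x h1 h2
    rw [h2, sub_self] at h1
    exact (smul_eq_zero.1 h1.symm).resolve_left (neg_ne_zero.2 hτ.ne')
  obtain ⟨c, hc⟩ := hzero.ae_const_of_zero hΩ hc
  refine ⟨c, ?_⟩
  filter_upwards [hc] with x hx
  linarith

/-- Every step of the scheme is uniquely solvable, whatever the size of the time step. -/
lemma exists_unique_isStep (hΩ : IsOpen Ω) (hc : IsConnected Ω) (hb : Bornology.IsBounded Ω)
    {P : Params} {τ t : ℝ} {s : State} (hτ : 0 < τ) (hM : 0 < P.M) (hν : 0 < P.ν) (hγ : 0 < P.γ)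
    (hT : 0 < P.T) (hs : Admissible Ω P s) :
    ∃ (ut : E2 → E2) (s' : State), IsStep Ω P τ t s ut s' ∧
      ∀ (ut₂ : E2 → E2) (s₂ : State), IsStep Ω P τ t s ut₂ s₂ → SameStep Ω ut₂ s₂ ut s' := by
  obtain ⟨φ, μ, ut, r, q, hφ, hμ, hut, hsol, huniq⟩ :=
    exists_unique_solvesDecoupled (t := t) hΩ hτ hM hν hγ hT hs
  obtain ⟨u, π, hu, hπ, hdec⟩ := exists_helmholtz hΩ hc hb hut.memLp
  have hp' := hs.p_mem.add_const_mul hπ τ⁻¹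
  have hstep : IsStep Ω P τ t s ut ⟨φ, μ, u, fun x => s.p x + τ⁻¹ * π x, r, q⟩ := by
    refine ⟨hφ, hμ, hut, hp', hsol.phi_eq, hsol.mu_eq, hsol.r_eq, hsol.ut_eq, hu, ?_, hsol.q_eq⟩
    have hg : IsWeakGrad Ω (fun y => s.p y + τ⁻¹ * π y - s.p y)
        (fun x => τ⁻¹ • weakGrad Ω π x) := by
      simpa only [add_sub_cancel_left] using hπ.isWeakGrad.const_smul τ⁻¹
    filter_upwards [hdec, hg.weakGrad_ae_eq hΩ] with x h1 h2
    rw [h2, h1, ← smul_add, sub_add_cancel_left, neg_add_cancel, smul_zero]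
  refine ⟨ut, _, hstep, fun ut₂ s₂ h₂ => ?_⟩
  obtain ⟨e1, e2, e3, e4, e5⟩ := huniq _ _ _ _ _ h₂.phi_mem h₂.mu_mem h₂.ut_mem h₂.solvesDecoupled
  obtain ⟨e6, e7⟩ := pressure_correction_unique hΩ hc hτ hs.p_mem e3 h₂.u_solenoidal
    hstep.u_solenoidal h₂.p_mem hstep.p_mem h₂.p_eq hstep.p_eq
  exact ⟨e1, e2, e3, e6, e7, e4, e5⟩

end Solvability

end CHNS

theorem mainTheorem1 (Ω : Set CHNS.E2) (hΩ_open : IsOpen Ω) (hΩ_conn : IsConnected Ω)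
    (hΩ_bdd : Bornology.IsBounded Ω) (P : CHNS.Params)
    (hM : 0 < P.M) (hν : 0 < P.ν) (hε : 0 < P.ε) (hγ : 0 < P.γ) (hT : 0 < P.T) :
    (∀ N n : ℕ, n < N →
      ∀ (s : CHNS.State) (ut : CHNS.E2 → CHNS.E2) (s' : CHNS.State),
        CHNS.Admissible Ω P s →
        CHNS.IsStep Ω P (P.T / N) ((n + 1) * (P.T / N)) s ut s' →
        CHNS.energy Ω P (P.T / N) s' - CHNS.energy Ω P (P.T / N) s
          ≤ -2 * P.M * (P.T / N) * (∫ x in Ω, ‖CHNS.weakGrad Ω s'.μ x‖ ^ 2)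
            - 2 * P.ν * (P.T / N)
                * (∑ i, ∫ x in Ω, ‖CHNS.weakGrad Ω (fun y => ut y i) x‖ ^ 2)
            - 2 * (P.T / N) / P.T * s'.q ^ 2) ∧
    (∃ τ₀ : ℝ, 0 < τ₀ ∧ ∀ N n : ℕ, n < N → P.T / N ≤ τ₀ →
      ∀ s : CHNS.State, CHNS.Admissible Ω P s →
        ∃ (ut : CHNS.E2 → CHNS.E2) (s' : CHNS.State),
          CHNS.IsStep Ω P (P.T / N) ((n + 1) * (P.T / N)) s ut s' ∧
          ∀ (ut₂ : CHNS.E2 → CHNS.E2) (s₂ : CHNS.State),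
            CHNS.IsStep Ω P (P.T / N) ((n + 1) * (P.T / N)) s ut₂ s₂ →
            CHNS.SameStep Ω ut₂ s₂ ut s') := by
  have hτ : ∀ N n : ℕ, n < N → 0 < P.T / (N : ℝ) := fun N n h =>
    div_pos hT (Nat.cast_pos.2 (Nat.zero_lt_of_lt h))
  refine ⟨fun N n hn s ut s' hs h => h.energy_le hΩ_open (hτ N n hn) hγ hs, 1, one_pos,
    fun N n hn _ s hs => ?_⟩
  exact CHNS.exists_unique_isStep hΩ_open hΩ_conn hΩ_bdd (hτ N n hn) hM hν hγ hT hs
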